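/- Let $d\in\mathbb N$ and let $\omega:[0,+\infty)\to[0,+\infty)$ be a non-quasianalytic subadditive weight function, i.e. a continuous increasing (in the sense of non-decreasing) function such that $(\alpha)$ $\omega(t_1+t_2)\le\omega(t_1)+\omega(t_2)$ for all $t_1,t_2\ge0$; $(\beta)$ $\int_1^{+\infty}\frac{\omega(t)}{t^2}\,dt<+\infty$; $(\gamma)$ $\log t=o(\omega(t))$ as $t\to+\infty$; $(\delta)$ $\varphi_\omega(t):=\omega(e^t)$, $t\in\mathbb R$, is convex. Write $\omega(\zeta):=\omega(|\zeta|)$ for vectors $\zeta$, where $|\cdot|$ is the Euclidean norm, and let $\varphi^*_\omega(s):=\sup_{t\ge0}\{ts-\varphi_\omega(t)\}$ be the Young conjugate of $\varphi_\omega$. Put $D^\alpha=(-i)^{|\alpha|}\partial^\alpha$ and $\hat u(\xi)=\int_{\mathbb R^d}e^{-i\langle x,\xi\rangle}u(x)\,dx$. Let $\mathcal S_\omega(\mathbb R^d)$ be the complex vector space of all $u\in\mathcal S(\mathbb R^d)$ such that, for all $\lambda>0$ and $\alpha\in\mathbb N_0^d$, $$\sup_{x\in\mathbb R^d}e^{\lambda\omega(x)}|D^\alpha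 u(x)|<+\infty\quad\text{and}\quad\sup_{\xi\in\mathbb R^d}e^{\lambda\omega(\xi)}|D^\alpha\hat u(\xi)|<+\infty,$$ with its standard system of seminorms $$p_{\lambda,\mu}(u):=\sup_{\alpha,\beta\in\mathbb N_0^d}\ \sup_{x\in\mathbb R^d}|x^\beta D^\alpha u(x)|\,e^{-\lambda\varphi^*_\omega(|\alpha|/\lambda)-\mu\varphi^*_\omega(|\beta|/\mu)},\qquad\lambda,\mu>0.$$ For $\varphi\in\mathcal S_\omega(\mathbb R^d)\setminus\{0\}$ and $f\in\mathcal S_\omega(\mathbb R^d)$, let $$V_\varphi f(z):=\int_{\mathbb R^d}f(y)\,\overline{\varphi(y-x)}\,e^{-i\langle y,\xi\rangle}\,dy,\qquad z=(x,\xi)\in\mathbb R^{2d},$$ be the short-time Fourier transform of $f$ with window $\varphi$, and $$\|V_\varphi f\|_{\omega,\lambda}:=\sup_{z\in\mathbb R^{2d}}|V_\varphi f(z)|\,e^{\lambda\omega(z)},\qquad\lambda>0.$$ **Proposition.** For every fixed $\varphi\in\mathcal S_\omega(\mathbb R^d)\setminus\{0\}$, all $p_{\lambda,\mu}$ and all $f\mapsto\|V_\varphi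 f\|_{\omega,\lambda}$ are (finite) seminorms on $\mathcal S_\omega(\mathbb R^d)$, and the two systems $(p_{\lambda,\mu})_{\lambda,\mu>0}$ and $(\|V_\varphi\,\cdot\,\|_{\omega,\lambda})_{\lambda>0}$ are equivalent: each seminorm of either system is bounded on $\mathcal S_\omega(\mathbb R^d)$ by a constant times the maximum of finitely many seminorms of the other. -/

import Mathlib

open scoped SchwartzMap FourierTransform

noncomputable section

namespace UltraSchwartz

/-- A non-quasianalytic subadditive weight function `ω : [0,∞) → [0,∞)`; only the values of `ω` on
`[0,∞)` matter. -/
structure IsWeight (ω : ℝ → ℝ) : Prop where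
  continuousOn : ContinuousOn ω (Set.Ici 0)
  monotoneOn : MonotoneOn ω (Set.Ici 0)
  nonneg : ∀ t, 0 ≤ t → 0 ≤ ω t
  subadditive : ∀ s t, 0 ≤ s → 0 ≤ t → ω (s + t) ≤ ω s + ω t
  nonquasianalytic : MeasureTheory.IntegrableOn (fun t : ℝ => ω t / t ^ 2) (Set.Ici 1)
  log_isLittleO : Real.log =o[Filter.atTop] ω
  convex_exp : ConvexOn ℝ Set.univ (fun t : ℝ => ω (Real.exp t))

/-- The Young conjugate `φ*_ω(s) = sup_{t ≥ 0} (t s - ω(e^t))` of `φ_ω(t) = ω(e^t)`.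
For a weight function the supremum is over a set bounded above, as `ω(e^t)/t → ∞`. -/
def youngConj (ω : ℝ → ℝ) (s : ℝ) : ℝ :=
  ⨆ t : Set.Ici (0 : ℝ), ((t : ℝ) * s - ω (Real.exp (t : ℝ)))

/-- `ℝ^d` with the Euclidean norm. -/
abbrev Rd (d : ℕ) : Type := EuclideanSpace ℝ (Fin d)

variable {d : ℕ}

/-- The partial derivative `∂_j g`. -/
def pderiv (j : Fin d) (g : Rd d → ℂ) : Rd d → ℂ :=
  fun x => fderiv ℝ g x (EuclideanSpace.single j 1)

/-- `∂^α = ∂_1^{α_1} ⋯ ∂_d^{α_d}`, applied to (smooth) functions. -/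
def multiDeriv (α : Fin d → ℕ) (g : Rd d → ℂ) : Rd d → ℂ :=
  (List.finRange d).foldr (fun j h => (pderiv j)^[α j] h) g

/-- `D^α = (-i)^{|α|} ∂^α`. -/
def multiD (α : Fin d → ℕ) (g : Rd d → ℂ) : Rd d → ℂ :=
  fun x => (-Complex.I) ^ (∑ j, α j) * multiDeriv α g x

/-- The Fourier transform `f̂(ξ) = ∫ e^{-i⟨x,ξ⟩} f(x) dx`. -/
def fourierHat (f : Rd d → ℂ) (ξ : Rd d) : ℂ :=
  ∫ x : Rd d, Complex.exp (-(Complex.I * ((inner ℝ x ξ : ℝ) : ℂ))) * f x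

/-- The short-time Fourier transform
`V_φ f(x,ξ) = ∫ f(y) conj(φ(y-x)) e^{-i⟨y,ξ⟩} dy`, where `z = (x,ξ) ∈ ℝ^{2d}`. -/
def stft (φ f : Rd d → ℂ) (z : Rd d × Rd d) : ℂ :=
  ∫ y : Rd d, f y * (starRingEnd ℂ) (φ (y - z.1)) *
    Complex.exp (-(Complex.I * ((inner ℝ y z.2 : ℝ) : ℂ)))

/-- The Euclidean norm of `z = (x,ξ) ∈ ℝ^{2d}` (the norm of the Lean product is the sup norm). -/
def phaseNorm (z : Rd d × Rd d) : ℝ := Real.sqrt (‖z.1‖ ^ 2 + ‖z.2‖ ^ 2)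

lemma contDiff_pderiv (j : Fin d) {g : Rd d → ℂ} (hg : ContDiff ℝ (⊤ : ℕ∞) g) :
    ContDiff ℝ (⊤ : ℕ∞) (pderiv j g) := by
  have h : ContDiff ℝ (⊤ : ℕ∞) (fderiv ℝ g) := hg.fderiv_right (by simp)
  exact h.clm_apply contDiff_const

lemma contDiff_iterate_pderiv (j : Fin d) (n : ℕ) {g : Rd d → ℂ} (hg : ContDiff ℝ (⊤ : ℕ∞) g) :
    ContDiff ℝ (⊤ : ℕ∞) ((pderiv j)^[n] g) := by
  induction n with
  | zero => simpa using hg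
  | succ n ih => rw [Function.iterate_succ_apply']; exact contDiff_pderiv j ih

lemma pderiv_lin (j : Fin d) (c : ℂ) {g h : Rd d → ℂ} (hg : ContDiff ℝ (⊤ : ℕ∞) g)
    (hh : ContDiff ℝ (⊤ : ℕ∞) h) : pderiv j (c • g + h) = c • pderiv j g + pderiv j h := by
  funext x
  have h1 : DifferentiableAt ℝ g x := (hg.differentiable (by simp)) x
  have h2 : DifferentiableAt ℝ h x := (hh.differentiable (by simp)) x
  simp only [pderiv, Pi.add_apply, Pi.smul_apply]
  rw [fderiv_add (h1.const_smul c) h2, fderiv_const_smul h1]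
  simp

lemma iterate_pderiv_lin (j : Fin d) (n : ℕ) (c : ℂ) {g h : Rd d → ℂ} (hg : ContDiff ℝ (⊤ : ℕ∞) g)
    (hh : ContDiff ℝ (⊤ : ℕ∞) h) :
    (pderiv j)^[n] (c • g + h) = c • (pderiv j)^[n] g + (pderiv j)^[n] h := by
  induction n with
  | zero => simp
  | succ n ih =>
    simp only [Function.iterate_succ_apply']
    rw [ih, pderiv_lin j c (contDiff_iterate_pderiv j n hg) (contDiff_iterate_pderiv j n hh)]

lemma multiDeriv_lin (α : Fin d → ℕ) (c : ℂ) {g h : Rd d → ℂ} (hg : ContDiff ℝ (⊤ : ℕ∞) g)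
    (hh : ContDiff ℝ (⊤ : ℕ∞) h) :
    multiDeriv α (c • g + h) = c • multiDeriv α g + multiDeriv α h := by
  have key : ∀ l : List (Fin d),
      ContDiff ℝ (⊤ : ℕ∞) (l.foldr (fun j h => (pderiv j)^[α j] h) g) ∧
      ContDiff ℝ (⊤ : ℕ∞) (l.foldr (fun j h => (pderiv j)^[α j] h) h) ∧
      l.foldr (fun j h => (pderiv j)^[α j] h) (c • g + h) =
        c • l.foldr (fun j h => (pderiv j)^[α j] h) g +
          l.foldr (fun j h => (pderiv j)^[α j] h) h := by
    intro l
    induction l with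
    | nil => exact ⟨hg, hh, rfl⟩
    | cons j l ih =>
      obtain ⟨h1, h2, h3⟩ := ih
      refine ⟨contDiff_iterate_pderiv j _ h1, contDiff_iterate_pderiv j _ h2, ?_⟩
      simp only [List.foldr_cons]
      rw [h3, iterate_pderiv_lin j _ c h1 h2]
  exact (key _).2.2

lemma multiD_lin (α : Fin d → ℕ) (c : ℂ) {g h : Rd d → ℂ} (hg : ContDiff ℝ (⊤ : ℕ∞) g)
    (hh : ContDiff ℝ (⊤ : ℕ∞) h) (x : Rd d) :
    multiD α (c • g + h) x = c * multiD α g x + multiD α h x := by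
  simp only [multiD, multiDeriv_lin α c hg hh, Pi.add_apply, Pi.smul_apply, smul_eq_mul]
  ring

lemma fourierHat_eq (f : 𝓢(Rd d, ℂ)) (ξ : Rd d) :
    fourierHat f ξ = (𝓕 f) ((2 * Real.pi)⁻¹ • ξ) := by
  rw [SchwartzMap.fourier_coe, Real.fourier_eq', fourierHat]
  congr 1
  funext x
  rw [smul_eq_mul, inner_smul_right]
  congr 2
  have : (Real.pi : ℂ) ≠ 0 := by exact_mod_cast Real.pi_ne_zero
  push_cast
  field_simp

lemma contDiff_fourierHat (f : 𝓢(Rd d, ℂ)) : ContDiff ℝ (⊤ : ℕ∞) (fourierHat (f : Rd d → ℂ)) := by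
  have : fourierHat (f : Rd d → ℂ) = fun ξ => (𝓕 f) ((2 * Real.pi)⁻¹ • ξ) :=
    funext (fourierHat_eq f)
  rw [this]
  exact ((𝓕 f).smooth ⊤).comp (contDiff_const_smul _)

lemma fourierHat_lin (c : ℂ) (f g : 𝓢(Rd d, ℂ)) :
    fourierHat (c • (f : Rd d → ℂ) + (g : Rd d → ℂ)) = c • fourierHat (f : Rd d → ℂ) + fourierHat g := by
  have h : (c • (f : Rd d → ℂ) + (g : Rd d → ℂ)) = ((c • f + g : 𝓢(Rd d, ℂ)) : Rd d → ℂ) := by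
    funext x; simp
  rw [h]
  funext ξ
  rw [Pi.add_apply, Pi.smul_apply, fourierHat_eq, fourierHat_eq, fourierHat_eq,
    FourierTransform.fourier_add, FourierTransform.fourier_smul]
  rfl

/-- `sup_x e^{λ ω(x)} |D^α g(x)| < ∞` for all `λ > 0` and all multi-indices `α`. -/
def WeightedDecay (ω : ℝ → ℝ) (g : Rd d → ℂ) : Prop :=
  ∀ l : ℝ, 0 < l → ∀ α : Fin d → ℕ,
    BddAbove (Set.range fun x : Rd d => Real.exp (l * ω ‖x‖) * ‖multiD α g x‖)

lemma WeightedDecay.lin {ω : ℝ → ℝ} {g h : Rd d → ℂ} (c : ℂ) (hg : ContDiff ℝ (⊤ : ℕ∞) g)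
    (hh : ContDiff ℝ (⊤ : ℕ∞) h) (wg : WeightedDecay ω g) (wh : WeightedDecay ω h) :
    WeightedDecay ω (c • g + h) := by
  intro l hl α
  obtain ⟨A, hA⟩ := wg l hl α
  obtain ⟨B, hB⟩ := wh l hl α
  refine ⟨‖c‖ * A + B, ?_⟩
  rintro _ ⟨x, rfl⟩
  have h1 := hA ⟨x, rfl⟩
  have h2 := hB ⟨x, rfl⟩
  simp only at h1 h2 ⊢
  rw [multiD_lin α c hg hh]
  calc Real.exp (l * ω ‖x‖) * ‖c * multiD α g x + multiD α h x‖
      ≤ Real.exp (l * ω ‖x‖) * (‖c‖ * ‖multiD α g x‖ + ‖multiD α h x‖) := by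
        gcongr
        exact (norm_add_le _ _).trans (by rw [norm_mul])
    _ = ‖c‖ * (Real.exp (l * ω ‖x‖) * ‖multiD α g x‖)
          + Real.exp (l * ω ‖x‖) * ‖multiD α h x‖ := by ring
    _ ≤ ‖c‖ * A + B := by gcongr

lemma weightedDecay_zero (ω : ℝ → ℝ) : WeightedDecay ω (0 : Rd d → ℂ) := by
  intro l _ α
  have h0 : multiDeriv α (0 : Rd d → ℂ) = 0 := by
    have := multiDeriv_lin α (-1 : ℂ) (g := (0 : Rd d → ℂ)) (h := 0) contDiff_const contDiff_const
    simpa using this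
  refine ⟨0, ?_⟩
  rintro _ ⟨x, rfl⟩
  simp [multiD, h0]

lemma fourierHat_zero : fourierHat (0 : Rd d → ℂ) = 0 := by
  funext ξ; simp [fourierHat]

/-- The weighted Schwartz space `𝒮_ω(ℝ^d)`, a complex vector space. -/
def SOmega (d : ℕ) (ω : ℝ → ℝ) : Submodule ℂ 𝓢(Rd d, ℂ) where
  carrier := {f | WeightedDecay ω (f : Rd d → ℂ) ∧ WeightedDecay ω (fourierHat (f : Rd d → ℂ))}
  zero_mem' := by
    have h : ((0 : 𝓢(Rd d, ℂ)) : Rd d → ℂ) = 0 := by funext x; simp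
    simp only [Set.mem_ofPred_eq, h, fourierHat_zero]
    exact ⟨weightedDecay_zero ω, weightedDecay_zero ω⟩
  add_mem' := by
    rintro f g ⟨hf, hf'⟩ ⟨hg, hg'⟩
    have h : ((f + g : 𝓢(Rd d, ℂ)) : Rd d → ℂ) = (1 : ℂ) • (f : Rd d → ℂ) + g := by
      funext x; simp
    refine ⟨?_, ?_⟩
    · rw [h]; exact hf.lin 1 (f.smooth ⊤) (g.smooth ⊤) hg
    · rw [h, fourierHat_lin]
      exact hf'.lin 1 (contDiff_fourierHat f) (contDiff_fourierHat g) hg'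
  smul_mem' := by
    rintro c f ⟨hf, hf'⟩
    have h : ((c • f : 𝓢(Rd d, ℂ)) : Rd d → ℂ) = c • (f : Rd d → ℂ) + (0 : 𝓢(Rd d, ℂ)) := by
      funext x; simp
    have h0 : ((0 : 𝓢(Rd d, ℂ)) : Rd d → ℂ) = 0 := by funext x; simp
    have z := weightedDecay_zero (d := d) ω
    refine ⟨?_, ?_⟩
    · rw [h]
      exact hf.lin c (f.smooth ⊤) (SchwartzMap.smooth 0 ⊤) (by rw [h0]; exact z)
    · rw [h, fourierHat_lin]
      exact hf'.lin c (contDiff_fourierHat f) (contDiff_fourierHat 0)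
        (by rw [h0, fourierHat_zero]; exact z)

/-- The standard seminorms of `𝒮_ω(ℝ^d)`, with values in `[0,∞]`:
`p_{λ,μ}(u) = sup_{α,β} sup_x |x^β D^α u(x)| e^{-λ φ*_ω(|α|/λ) - μ φ*_ω(|β|/μ)}`. -/
def pSup (ω : ℝ → ℝ) (l m : ℝ) (u : Rd d → ℂ) : ENNReal :=
  ⨆ (α : Fin d → ℕ) (β : Fin d → ℕ) (x : Rd d), ENNReal.ofReal
    (‖((∏ j, x j ^ β j : ℝ) : ℂ) * multiD α u x‖ *
      Real.exp (-(l * youngConj ω (((∑ j, α j : ℕ) : ℝ) / l))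
        - m * youngConj ω (((∑ j, β j : ℕ) : ℝ) / m)))

/-- `‖V_φ f‖_{ω,λ} = sup_{z ∈ ℝ^{2d}} |V_φ f(z)| e^{λ ω(z)}`, with values in `[0,∞]`. -/
def stftSup (ω : ℝ → ℝ) (l : ℝ) (φ f : Rd d → ℂ) : ENNReal :=
  ⨆ z : Rd d × Rd d, ENNReal.ofReal (‖stft φ f z‖ * Real.exp (l * ω (phaseNorm z)))

end UltraSchwartz

end

noncomputable section

namespace UltraSchwartz

/-! ### Growth of weight functions. -/

namespace IsWeight

/-! Both systems are compared with a third, in which no derivatives occur: the bounds sup |f| e^{Lω}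
and sup |𝓕 f| e^{Lω} for L > 0 (`DecayBound`). Four estimates, each costing a constant and a change
of parameter, close the loop.

Decay to V_φ f (`norm_normStft_le_phase`): subadditivity of ω gives decay in x, and |V_φ f(x,ξ)| =
|V_{𝓕φ} 𝓕f(ξ,-x)| turns the same estimate into decay in ξ. V_φ f to decay
(`exists_decayBound_of_normStft_le`): if φ(w) ≠ 0, Fourier inversion in ξ writes f(y) conj φ(w) as
an integral of V_φ f(y-w, ·); the window 𝓕 φ does the same for 𝓕 f.

Decay to p (`exists_norm_iteratedFDeriv_le`): localise f at y by a Gaussian. The Fourier transform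
of the product H is a short-time Fourier transform, so it decays in y and in ξ, and its moments
bound the derivatives of H by e^{lφ*(n/l)}. Removing the Gaussian at y costs, by Leibniz, factors
a^k k!; these are harmless because non-quasianalyticity forces ω(t) = o(t). Thus decay in y and
control of all derivatives come out together.

p to decay (`exists_decayBound_of_pSup_le`): convexity of ω(e^t), i.e. biconjugation, turns moment
bounds in one coordinate into weighted decay. For 𝓕 f the moments come from the pure derivatives
∂_j^n f.

The work is done with the kernel e^{-2πi⟨y,ξ⟩}; rescaling frequencies by 2π only changes constants
in front of ω. -/

lemma mono {ω : ℝ → ℝ} (hω : IsWeight ω) {s t : ℝ} (hs : 0 ≤ s) (h : s ≤ t) : ω s ≤ ω t :=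
  hω.monotoneOn hs (hs.trans h) h

lemma nat_succ_mul_le {ω : ℝ → ℝ} (hω : IsWeight ω) (n : ℕ) {t : ℝ} (ht : 0 ≤ t) :
    ω ((n + 1) * t) ≤ (n + 1) * ω t := by
  induction n with
  | zero => simp
  | succ n ih =>
    have h := hω.subadditive ((n + 1) * t) t (by positivity) ht
    push_cast
    rw [show ((n : ℝ) + 1 + 1) * t = (n + 1) * t + t by ring]
    linarith

lemma nat_mul_le {ω : ℝ → ℝ} (hω : IsWeight ω) {n : ℕ} (hn : 1 ≤ n) {t : ℝ} (ht : 0 ≤ t) :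
    ω (n * t) ≤ n * ω t := by
  obtain ⟨m, rfl⟩ := Nat.exists_eq_add_of_le' hn
  exact_mod_cast hω.nat_succ_mul_le m ht

lemma continuous_norm {ω : ℝ → ℝ} (hω : IsWeight ω) {E : Type*} [NormedAddCommGroup E] :
    Continuous fun x : E => ω ‖x‖ :=
  hω.continuousOn.comp_continuous _root_.continuous_norm fun x => norm_nonneg x

lemma add_norm_le {ω : ℝ → ℝ} (hω : IsWeight ω) {E : Type*} [NormedAddCommGroup E] (x y : E) :
    ω ‖x‖ ≤ ω ‖y‖ + ω ‖y - x‖ := by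
  refine le_trans (hω.mono (norm_nonneg x) ?_)
    (hω.subadditive ‖y‖ ‖y - x‖ (norm_nonneg _) (norm_nonneg _))
  have := norm_sub_le y (y - x)
  simpa using this

/-- `log t = o(ω(t))`, in the form of a global inequality. -/
lemma exists_log_le {ω : ℝ → ℝ} (hω : IsWeight ω) {ε : ℝ} (hε : 0 < ε) :
    ∃ C, 0 ≤ C ∧ ∀ t, 1 ≤ t → Real.log t ≤ ε * ω t + C := by
  obtain ⟨T, hT⟩ := Filter.eventually_atTop.1 (hω.log_isLittleO.bound hε)
  refine ⟨Real.log (max T 1), Real.log_nonneg (le_max_right _ _), fun t ht => ?_⟩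
  have h0 := hω.nonneg t (by linarith)
  rcases le_total T t with h | h
  · have h1 := hT t h
    rw [Real.norm_of_nonneg (Real.log_nonneg ht), Real.norm_of_nonneg h0] at h1
    have := Real.log_nonneg (le_max_right T 1)
    linarith
  · have := Real.log_le_log (by linarith) (h.trans (le_max_left T 1))
    have := mul_nonneg hε.le h0
    linarith

/-- `ω(t) = o(t)`, in the form of a global inequality. -/
lemma exists_le_mul_add {ω : ℝ → ℝ} (hω : IsWeight ω) {ε : ℝ} (hε : 0 < ε) :
    ∃ C, 0 ≤ C ∧ ∀ t, 0 ≤ t → ω t ≤ ε * t + C := by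
  obtain ⟨T, hT, hT'⟩ : ∃ T, 1 ≤ T ∧ ω T ≤ ε * T := by
    -- Otherwise ω(t)/t² > ε/t on [1,∞), against integrability. One good point T suffices:
    -- subadditivity spreads the bound to all multiples of T.
    by_contra! h
    refine not_integrableOn_Ici_inv (a := (1 : ℝ)) ?_
    refine (hω.nonquasianalytic.const_mul ε⁻¹).mono'
      (measurable_inv.aestronglyMeasurable) ?_
    refine (MeasureTheory.ae_restrict_iff' measurableSet_Ici).2 (.of_forall fun t ht => ?_)
    have ht' : (1 : ℝ) ≤ t := ht
    have ht0 : 0 < t := by linarith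
    rw [Real.norm_of_nonneg (by positivity)]
    rw [show ε⁻¹ * (ω t / t ^ 2) = ω t / (ε * t ^ 2) by field_simp, le_div_iff₀ (by positivity)]
    have := (h t ht').le
    calc t⁻¹ * (ε * t ^ 2) = ε * t := by field_simp
      _ ≤ _ := this
  have hT0 : 0 < T := by linarith
  have hωT := hω.nonneg T hT0.le
  refine ⟨ω T, hωT, fun t ht => ?_⟩
  have h1 : t ≤ (⌊t / T⌋₊ + 1) * T := by
    rw [← div_le_iff₀ hT0]; exact (Nat.lt_floor_add_one _).le
  have h2 := (hω.mono ht h1).trans (hω.nat_succ_mul_le ⌊t / T⌋₊ hT0.le)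
  have h3 : (⌊t / T⌋₊ : ℝ) ≤ t / T := Nat.floor_le (by positivity)
  have h4 : (⌊t / T⌋₊ : ℝ) * ω T ≤ t / T * (ε * T) := by gcongr
  have h5 : t / T * (ε * T) = ε * t := by field_simp
  linarith

/-- Since log t = o(ω(t)), e^{-kω} beats every power; the relevant ε is k/r. This is the source of
all integrability below. -/
lemma exists_exp_neg_le {ω : ℝ → ℝ} (hω : IsWeight ω) {k r : ℝ} (hk : 0 < k) (hr : 0 < r) :
    ∃ C, 0 < C ∧ ∀ t, 0 ≤ t → Real.exp (-(k * ω t)) ≤ C * (1 + t) ^ (-r) := by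
  obtain ⟨C, hC0, hC⟩ := hω.exists_log_le (div_pos hk hr)
  refine ⟨Real.exp (r * (Real.log 2 + C)), Real.exp_pos _, fun t ht => ?_⟩
  rw [Real.rpow_def_of_pos (by linarith), ← Real.exp_add]
  apply Real.exp_le_exp.2
  have h2 : 0 ≤ Real.log 2 := Real.log_nonneg (by norm_num)
  have key : Real.log (1 + t) ≤ Real.log 2 + C + k / r * ω t := by
    rcases le_total 1 t with h | h
    · have := hC t h
      have h3 := Real.log_le_log (by linarith) (show 1 + t ≤ 2 * t by linarith)
      rw [Real.log_mul (by norm_num) (by linarith)] at h3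
      linarith
    · have h3 := Real.log_le_log (by linarith) (show 1 + t ≤ 2 by linarith)
      have := mul_nonneg (div_pos hk hr).le (hω.nonneg t ht)
      linarith
  have := mul_le_mul_of_nonneg_left key hr.le
  have h4 : r * (Real.log 2 + C + k / r * ω t) = r * (Real.log 2 + C) + k * ω t := by
    field_simp
  linarith

lemma integrable_exp_neg {ω : ℝ → ℝ} (hω : IsWeight ω) {d : ℕ} {k : ℝ} (hk : 0 < k) :
    MeasureTheory.Integrable fun x : Rd d => Real.exp (-(k * ω ‖x‖)) := by
  obtain ⟨C, hC0, hC⟩ := hω.exists_exp_neg_le hk (r := d + 1) (by positivity)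
  have hi : MeasureTheory.Integrable fun x : Rd d => C * (1 + ‖x‖) ^ (-((d : ℝ) + 1)) :=
    (integrable_one_add_norm (by simp)).const_mul C
  refine hi.mono' ?_ (.of_forall fun x => ?_)
  · exact (Real.continuous_exp.comp
      (continuous_const.mul hω.continuous_norm).neg).aestronglyMeasurable
  · rw [Real.norm_of_nonneg (Real.exp_nonneg _)]
    exact hC _ (norm_nonneg x)

lemma integrable_pow_mul_exp_neg {ω : ℝ → ℝ} (hω : IsWeight ω) {d : ℕ} {k : ℝ} (hk : 0 < k)
    (n : ℕ) :
    MeasureTheory.Integrable fun x : Rd d => ‖x‖ ^ n * Real.exp (-(k * ω ‖x‖)) := by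
  obtain ⟨C, hC0, hC⟩ := hω.exists_exp_neg_le hk (r := d + 1 + n) (by positivity)
  have hi : MeasureTheory.Integrable fun x : Rd d => C * (1 + ‖x‖) ^ (-((d : ℝ) + 1)) :=
    (integrable_one_add_norm (by simp)).const_mul C
  refine hi.mono' ?_ (.of_forall fun x => ?_)
  · exact ((_root_.continuous_norm.pow n).mul (Real.continuous_exp.comp
      (continuous_const.mul hω.continuous_norm).neg)).aestronglyMeasurable
  · have h1 : 0 < 1 + ‖x‖ := by positivity
    rw [Real.norm_of_nonneg (by positivity)]
    calc ‖x‖ ^ n * Real.exp (-(k * ω ‖x‖))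
        ≤ (1 + ‖x‖) ^ n * (C * (1 + ‖x‖) ^ (-((d : ℝ) + 1 + n))) := by
          gcongr
          · linarith
          · exact hC _ (norm_nonneg x)
      _ = C * (1 + ‖x‖) ^ (-((d : ℝ) + 1)) := by
          rw [show -((d : ℝ) + 1) = -((d : ℝ) + 1 + n) + n by ring, Real.rpow_add h1,
            Real.rpow_natCast]
          ring

/-! ### The Young conjugate -/

lemma bddAbove_youngConj {ω : ℝ → ℝ} (hω : IsWeight ω) (s : ℝ) :
    BddAbove (Set.range fun t : Set.Ici (0 : ℝ) => (t : ℝ) * s - ω (Real.exp (t : ℝ))) := by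
  obtain ⟨C, -, hC⟩ := hω.exists_log_le (ε := (|s| + 1)⁻¹) (by positivity)
  refine ⟨(|s| + 1) * C, ?_⟩
  rintro _ ⟨⟨t, ht⟩, rfl⟩
  have ht' : (0 : ℝ) ≤ t := ht
  have h := hC (Real.exp t) (Real.one_le_exp ht')
  rw [Real.log_exp] at h
  have h2 := mul_le_mul_of_nonneg_left h (show 0 ≤ |s| + 1 by positivity)
  have h3 : (|s| + 1) * ((|s| + 1)⁻¹ * ω (Real.exp t) + C) = ω (Real.exp t) + (|s| + 1) * C := by
    field_simp
  have h4 : t * s ≤ t * |s| := by gcongr; exact le_abs_self s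
  simp only
  linarith

lemma le_youngConj {ω : ℝ → ℝ} (hω : IsWeight ω) (s : ℝ) {t : ℝ} (ht : 0 ≤ t) :
    t * s - ω (Real.exp t) ≤ youngConj ω s :=
  le_ciSup (hω.bddAbove_youngConj s) (⟨t, ht⟩ : Set.Ici (0 : ℝ))

lemma youngConj_le {ω : ℝ → ℝ} {s B : ℝ} (h : ∀ t, 0 ≤ t → t * s - ω (Real.exp t) ≤ B) :
    youngConj ω s ≤ B :=
  ciSup_le fun t : Set.Ici (0 : ℝ) => h t t.2

lemma youngConj_mono {ω : ℝ → ℝ} (hω : IsWeight ω) {s r : ℝ} (h : s ≤ r) :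
    youngConj ω s ≤ youngConj ω r :=
  youngConj_le fun t ht => le_trans (by gcongr) (hω.le_youngConj r ht)

lemma neg_le_youngConj {ω : ℝ → ℝ} (hω : IsWeight ω) (s : ℝ) : -ω 1 ≤ youngConj ω s := by
  simpa using hω.le_youngConj s le_rfl

/-- Of the two test points the larger one serves for s + r, and the other value of ω is dropped.
This recombines the two factors of a Leibniz term. -/
lemma youngConj_add_le {ω : ℝ → ℝ} (hω : IsWeight ω) {s r : ℝ} (hs : 0 ≤ s) (hr : 0 ≤ r) :
    youngConj ω s + youngConj ω r ≤ youngConj ω (s + r) := by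
  rw [← le_sub_iff_add_le]
  refine youngConj_le fun t ht => ?_
  rw [le_sub_comm]
  refine youngConj_le fun u hu => ?_
  have h1 := hω.nonneg _ (Real.exp_nonneg t)
  have h2 := hω.nonneg _ (Real.exp_nonneg u)
  rcases le_total t u with h | h
  · have := hω.le_youngConj (s + r) hu
    nlinarith [mul_le_mul_of_nonneg_right h hs]
  · have := hω.le_youngConj (s + r) ht
    nlinarith [mul_le_mul_of_nonneg_right h hr]

/-- Young's inequality at log t. The supremum in `youngConj` runs over nonnegative arguments only,
so t < 1 is treated apart, at the price of e^{lω(1)}. -/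
lemma pow_mul_exp_neg_le {ω : ℝ → ℝ} (hω : IsWeight ω) {l : ℝ} (hl : 0 < l) (n : ℕ) {t : ℝ}
    (ht : 0 ≤ t) :
    t ^ n * Real.exp (-(l * ω t)) ≤ Real.exp (l * ω 1) * Real.exp (l * youngConj ω (n / l)) := by
  have h0 := hω.nonneg t ht
  have h1 := hω.nonneg 1 zero_le_one
  rcases le_total 1 t with h | h
  · have h2 := hω.le_youngConj (n / l) (Real.log_nonneg h)
    rw [Real.exp_log (by linarith)] at h2
    have h3 : t ^ n = Real.exp (n * Real.log t) := by
      rw [mul_comm, Real.exp_mul, Real.exp_log (by linarith), Real.rpow_natCast]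
    rw [h3, ← Real.exp_add, ← Real.exp_add]
    apply Real.exp_le_exp.2
    have h4 := mul_le_mul_of_nonneg_left h2 hl.le
    have h5 : l * (Real.log t * (n / l) - ω t) = n * Real.log t - l * ω t := by
      field_simp
    have := mul_nonneg hl.le h1
    linarith
  · rw [← Real.exp_add]
    have h2 := mul_le_mul_of_nonneg_left (hω.neg_le_youngConj (n / l)) hl.le
    calc t ^ n * Real.exp (-(l * ω t)) ≤ 1 * 1 := by
          gcongr
          · exact pow_le_one₀ ht h
          · exact Real.exp_le_one_iff.2 (by have := mul_nonneg hl.le h0; linarith)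
      _ ≤ _ := by rw [one_mul]; exact Real.one_le_exp (by linarith)

/-- Geometric factors a^n are absorbed by lowering the parameter from K l to l: shift the variable
of the conjugate by log a and use ω(a e^t) ≤ K ω(e^t). -/
lemma pow_mul_exp_youngConj_le {ω : ℝ → ℝ} (hω : IsWeight ω) {K : ℕ} (hK : 1 ≤ K) {a : ℝ}
    (ha : 1 ≤ a) (haK : a ≤ K) {l : ℝ} (hl : 0 < l) (n : ℕ) :
    a ^ n * Real.exp (K * l * youngConj ω (n / (K * l))) ≤ Real.exp (l * youngConj ω (n / l)) := by
  have hK0 : (0 : ℝ) < K := by exact_mod_cast hK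
  have h3 : a ^ n = Real.exp (n * Real.log a) := by
    rw [mul_comm, Real.exp_mul, Real.exp_log (by linarith), Real.rpow_natCast]
  rw [h3, ← Real.exp_add]
  apply Real.exp_le_exp.2
  rw [← le_sub_iff_add_le', ← le_div_iff₀' (by positivity)]
  refine youngConj_le fun t ht => ?_
  rw [le_div_iff₀' (by positivity)]
  have h1 := hω.le_youngConj (n / l) (add_nonneg ht (Real.log_nonneg ha))
  rw [Real.exp_add, Real.exp_log (by linarith)] at h1
  have h2 : ω (Real.exp t * a) ≤ K * ω (Real.exp t) := by
    refine le_trans (hω.mono (by positivity) ?_) (hω.nat_mul_le hK (Real.exp_nonneg t))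
    rw [mul_comm]; gcongr
  have h4 := mul_le_mul_of_nonneg_left
    ((sub_le_sub_left h2 ((t + Real.log a) * (n / l))).trans h1) hl.le
  have h5 : l * ((t + Real.log a) * (n / l) - K * ω (Real.exp t))
      = (t + Real.log a) * n - l * K * ω (Real.exp t) := by field_simp
  have h6 : K * l * (t * (n / (K * l)) - ω (Real.exp t)) = t * n - l * K * ω (Real.exp t) := by
    field_simp
  linarith

/-- Derivatives of analytic size are admissible: with ω(t) = o(t), test the Young inequality at a
point proportional to k. -/
lemma exists_factorial_le {ω : ℝ → ℝ} (hω : IsWeight ω) {a l : ℝ} (ha : 0 < a) (hl : 0 < l) :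
    ∃ C, 0 < C ∧ ∀ k : ℕ, a ^ k * (k.factorial : ℝ) ≤ C * Real.exp (l * youngConj ω (k / l)) := by
  -- The factor e in b gains e^k, which pays for lω(bk) ≤ k + lC; this is why ε is 1/(lb).
  set b := max (a * Real.exp 1) 1 with hb
  have hb1 : 1 ≤ b := le_max_right _ _
  obtain ⟨C, hC0, hC⟩ := hω.exists_le_mul_add (ε := (l * b)⁻¹) (by positivity)
  refine ⟨Real.exp (l * (C + ω 1)), Real.exp_pos _, fun k => ?_⟩
  have h1 := hω.nonneg 1 zero_le_one
  rcases Nat.eq_zero_or_pos k with rfl | hk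
  · rw [← Real.exp_add]
    have h2 := mul_le_mul_of_nonneg_left (hω.neg_le_youngConj ((0 : ℕ) / l)) hl.le
    simp only [pow_zero, Nat.factorial_zero, Nat.cast_one, one_mul]
    apply Real.one_le_exp
    nlinarith [mul_nonneg hl.le hC0]
  · have hk1 : (1 : ℝ) ≤ k := by exact_mod_cast hk
    have ht : 1 ≤ b * k := by nlinarith
    have h2 := hω.pow_mul_exp_neg_le hl k (t := b * k) (by linarith)
    have h3 := hC (b * k) (by linarith)
    have h4 : l * ω (b * k) ≤ k + l * C := by
      have := mul_le_mul_of_nonneg_left h3 hl.le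
      have h5 : l * ((l * b)⁻¹ * (b * k) + C) = k + l * C := by field_simp
      linarith
    have h5 : a ^ k * (k.factorial : ℝ) ≤ (a * k) ^ k := by
      rw [mul_pow]; gcongr; exact_mod_cast Nat.factorial_le_pow k
    have h6 : (a * k) ^ k * Real.exp k ≤ (b * k) ^ k := by
      rw [← Real.exp_one_pow, ← mul_pow]
      have : a * Real.exp 1 ≤ b := le_max_left _ _
      exact pow_le_pow_left₀ (by positivity) (by nlinarith) k
    have h7 : a ^ k * (k.factorial : ℝ) ≤
        Real.exp (l * C) * ((b * k) ^ k * Real.exp (-(l * ω (b * k)))) := by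
      calc a ^ k * (k.factorial : ℝ) ≤ (a * k) ^ k := h5
        _ = (a * k) ^ k * Real.exp k * Real.exp (-k) := by
            rw [mul_assoc, ← Real.exp_add]; simp
        _ ≤ (b * k) ^ k * Real.exp (-k) := by gcongr
        _ ≤ (b * k) ^ k * (Real.exp (l * C) * Real.exp (-(l * ω (b * k)))) := by
            rw [← Real.exp_add]; gcongr; linarith
        _ = _ := by ring
    refine h7.trans ?_
    rw [mul_add, Real.exp_add, mul_assoc]
    gcongr

/-- A consequence of `φ** = φ`: integer moment bounds with constants `e^{m φ*(n/m)}` imply decay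
of order `t e^{-m ω(t)}`. -/
lemma le_of_forall_pow_mul_le {ω : ℝ → ℝ} (hω : IsWeight ω) {m B G t : ℝ} (hm : 0 < m)
    (hB : 0 ≤ B) (ht : 1 ≤ t)
    (h : ∀ n : ℕ, t ^ n * G ≤ B * Real.exp (m * youngConj ω (n / m))) :
    G ≤ B * (t * Real.exp (-(m * ω t))) := by
  have ht0 : 0 < t := by linarith
  set τ := Real.log t with hτ
  have hτ0 : 0 ≤ τ := Real.log_nonneg ht
  have hexp : Real.exp τ = t := Real.exp_log ht0
  have hmem : τ ∈ interior (Set.univ : Set ℝ) := by simp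
  set s := derivWithin (fun u => ω (Real.exp u)) (Set.Ioi τ) τ with hs
  -- The right derivative s is the slope of a supporting line of the convex function at τ = log t,
  -- so φ*(s) ≤ sτ - ω(t).
  have hsub : ∀ u, ω t + s * (u - τ) ≤ ω (Real.exp u) := by
    intro u
    rcases lt_trichotomy u τ with hu | rfl | hu
    · have h1 := hω.convex_exp.slope_le_leftDeriv_of_mem_interior (x := u) (y := τ)
        (Set.mem_univ _) hmem hu
      have h2 := h1.trans (hω.convex_exp.leftDeriv_le_rightDeriv_of_mem_interior hmem)
      rw [slope_def_field, ← hs, div_le_iff₀ (by linarith), hexp] at h2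
      linarith
    · simp [hexp]
    · have h1 := hω.convex_exp.rightDeriv_le_slope_of_mem_interior hmem (Set.mem_univ u) hu
      rw [slope_def_field, ← hs, le_div_iff₀ (by linarith), hexp] at h1
      linarith
  have hs0 : 0 ≤ s := by
    have h1 := hsub (τ - 1)
    have h2 : ω (Real.exp (τ - 1)) ≤ ω t := by
      rw [← hexp]; exact hω.mono (Real.exp_nonneg _) (Real.exp_le_exp.2 (by linarith))
    linarith
  set n := ⌊m * s⌋₊ with hn
  -- The optimal exponent is m s; rounding it down to an integer loses less than one power of t,
  -- whence the factor t in the conclusion.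
  have hn1 : (n : ℝ) ≤ m * s := Nat.floor_le (by positivity)
  have hn2 : m * s < n + 1 := Nat.lt_floor_add_one _
  have hy : youngConj ω (n / m) ≤ s * τ - ω t := by
    refine (hω.youngConj_mono (show (n : ℝ) / m ≤ s by rwa [div_le_iff₀' hm])).trans ?_
    exact youngConj_le fun u _ => by nlinarith [hsub u]
  have h3 : t ^ n = Real.exp (n * τ) := by
    rw [mul_comm, Real.exp_mul, hexp, Real.rpow_natCast]
  have h4 := h n
  rw [h3, mul_comm, ← le_div_iff₀ (Real.exp_pos _), mul_div_assoc, ← Real.exp_sub] at h4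
  refine h4.trans ?_
  gcongr
  calc Real.exp (m * youngConj ω (n / m) - n * τ) ≤ Real.exp (τ + -(m * ω t)) := by
        apply Real.exp_le_exp.2
        have h5 := mul_le_mul_of_nonneg_left hy hm.le
        nlinarith [mul_le_mul_of_nonneg_right hn2.le hτ0]
    _ = _ := by rw [Real.exp_add, hexp]

end IsWeight

/-! ### The short-time Fourier transform and decay of `f` and `𝓕 f`. -/

/-- `f` decays like `e^{-l ω}`, with constant `B`. -/
def DecayBound {d : ℕ} (ω : ℝ → ℝ) (l B : ℝ) (f : Rd d → ℂ) : Prop :=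
  ∀ x, ‖f x‖ ≤ B * Real.exp (-(l * ω ‖x‖))

lemma DecayBound.nonneg {d : ℕ} {ω : ℝ → ℝ} {l B : ℝ} {f : Rd d → ℂ} (h : DecayBound ω l B f) :
    0 ≤ B :=
  nonneg_of_mul_nonneg_left ((norm_nonneg _).trans (h 0)) (Real.exp_pos _)

/-- The short-time Fourier transform with the normalisation `e^{-2πi⟨y,ξ⟩}`. -/
def normStft {d : ℕ} (g f : Rd d → ℂ) (x ξ : Rd d) : ℂ :=
  𝓕 (fun y => f y * (starRingEnd ℂ) (g (y - x))) ξ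

lemma stft_eq_normStft {d : ℕ} (g f : Rd d → ℂ) (z : Rd d × Rd d) :
    stft g f z = normStft g f z.1 ((2 * Real.pi)⁻¹ • z.2) := by
  rw [normStft, Real.fourier_eq', stft]
  congr 1
  funext y
  rw [smul_eq_mul, inner_smul_right, mul_comm]
  congr 2
  have : (Real.pi : ℂ) ≠ 0 := by exact_mod_cast Real.pi_ne_zero
  push_cast
  field_simp

/-- The multiplication formula ∫ 𝓕F · G = ∫ F · 𝓕G for F a modulation of f and G a modulation of
conj 𝓕 g: 𝓕 F is a translate of 𝓕 f, and 𝓕 G a translate of conj g by Fourier inversion. Only a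
unimodular factor is left over. -/
lemma norm_normStft_fourier {d : ℕ} {f g : Rd d → ℂ} (hf : MeasureTheory.Integrable f)
    (hgc : Continuous g) (hg : MeasureTheory.Integrable g)
    (hg' : MeasureTheory.Integrable (𝓕 g)) (x ξ : Rd d) :
    ‖normStft g f x ξ‖ = ‖normStft (𝓕 g) (𝓕 f) ξ (-x)‖ := by
  set F : Rd d → ℂ := fun y => Real.fourierChar (-inner ℝ y ξ) • f y with hF
  set G : Rd d → ℂ := fun η => Real.fourierChar (inner ℝ η x) • (starRingEnd ℂ) (𝓕 g η) with hG
  have hFi : MeasureTheory.Integrable F := (Real.fourierIntegral_convergent_iff ξ).2 hf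
  have hGi : MeasureTheory.Integrable G := by
    have h1 : MeasureTheory.Integrable fun η => (starRingEnd ℂ) (𝓕 g η) :=
      (Complex.conjLIE.integrable_comp_iff).2 hg'
    have := (Real.fourierIntegral_convergent_iff (-x)).2 h1
    simpa [hG] using this
  have hFF : ∀ η, 𝓕 F η = 𝓕 f (η + ξ) := by
    intro η
    rw [Real.fourier_eq, Real.fourier_eq]
    congr 1; funext v
    rw [hF]
    simp only
    rw [smul_smul, ← AddChar.map_add_eq_mul, inner_add_right, neg_add]
  have hGF : ∀ y, 𝓕 G y = (starRingEnd ℂ) (g (y - x)) := by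
    intro y
    rw [← hgc.fourierInv_fourier_eq hg hg', Real.fourierInv_eq, Real.fourier_eq,
      ← integral_conj]
    congr 1; funext v
    rw [hG]
    simp only
    rw [smul_smul, ← AddChar.map_add_eq_mul, inner_sub_right, Circle.smul_def, Circle.smul_def,
      smul_eq_mul, smul_eq_mul, map_mul, ← Circle.coe_inv_eq_conj, ← AddChar.map_neg_eq_inv]
    congr 3
    ring
  have key : ∫ η, 𝓕 F η • G η = ∫ y, F y • 𝓕 G y := by
    simpa using! VectorFourier.integral_fourierIntegral_smul_eq_flip (L := innerₗ (Rd d))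
      Real.continuous_fourierChar continuous_inner hFi hGi
  have hL : normStft g f x ξ = ∫ y, F y • 𝓕 G y := by
    rw [normStft, Real.fourier_eq]
    congr 1; funext y
    rw [hGF, hF]
    simp only
    simp only [Circle.smul_def, smul_eq_mul]
    ring
  have hR : ∫ η, 𝓕 F η • G η
      = Real.fourierChar (-inner ℝ ξ x) • normStft (𝓕 g) (𝓕 f) ξ (-x) := by
    rw [normStft, Real.fourier_eq, ← MeasureTheory.integral_sub_right_eq_self _ ξ,
      Circle.smul_def, ← MeasureTheory.integral_smul]
    congr 1; funext y
    rw [hFF, hG]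
    simp only
    rw [← Circle.smul_def, smul_smul, ← AddChar.map_add_eq_mul, sub_add_cancel, smul_eq_mul,
      mul_smul_comm, inner_neg_right, inner_sub_left]
    congr 2
    ring
  rw [hL, ← key, hR, Circle.norm_smul]

/-- Subadditivity gives ω(x) ≤ ω(y) + ω(y-x), so rate l in both factors yields rate l in x; the
extra 1 in the rate of f makes the y-integral converge. -/
lemma norm_normStft_le {d : ℕ} {ω : ℝ → ℝ} (hω : IsWeight ω) {l A B : ℝ} (hl : 0 ≤ l)
    {f g : Rd d → ℂ} (hf : DecayBound ω (l + 1) A f) (hg : DecayBound ω l B g) (x ξ : Rd d) :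
    ‖normStft g f x ξ‖ ≤
      A * B * (∫ y : Rd d, Real.exp (-(1 * ω ‖y‖))) * Real.exp (-(l * ω ‖x‖)) := by
  have hA := hf.nonneg
  have hB := hg.nonneg
  rw [normStft, Real.fourier_eq]
  have hi := (hω.integrable_exp_neg (d := d) one_pos).const_mul (A * B * Real.exp (-(l * ω ‖x‖)))
  refine (MeasureTheory.norm_integral_le_of_norm_le hi (.of_forall fun y => ?_)).trans ?_
  · rw [Circle.norm_smul, norm_mul, RCLike.norm_conj]
    calc ‖f y‖ * ‖g (y - x)‖
        ≤ (A * Real.exp (-((l + 1) * ω ‖y‖))) * (B * Real.exp (-(l * ω ‖y - x‖))) := by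
          gcongr
          · exact hf y
          · exact hg _
      _ = A * B * Real.exp (-((l + 1) * ω ‖y‖) + -(l * ω ‖y - x‖)) := by
          rw [Real.exp_add]; ring
      _ ≤ A * B * Real.exp (-(l * ω ‖x‖) + -(1 * ω ‖y‖)) := by
          refine mul_le_mul_of_nonneg_left (Real.exp_le_exp.2 ?_) (by positivity)
          have := mul_le_mul_of_nonneg_left (hω.add_norm_le x y) hl
          linarith
      _ = _ := by rw [Real.exp_add]; ring
  · rw [MeasureTheory.integral_const_mul]
    apply le_of_eq; ring

/-- Decay of `f`, `g` and of their Fourier transforms gives decay of the short-time Fourier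
transform in phase space. -/
lemma norm_normStft_le_phase {d : ℕ} {ω : ℝ → ℝ} (hω : IsWeight ω) {l A B : ℝ} (hl : 0 ≤ l)
    {f g : Rd d → ℂ} (hfi : MeasureTheory.Integrable f) (hgc : Continuous g)
    (hgi : MeasureTheory.Integrable g) (hgi' : MeasureTheory.Integrable (𝓕 g))
    (hf : DecayBound ω (2 * l + 1) A f) (hf' : DecayBound ω (2 * l + 1) A (𝓕 f))
    (hg : DecayBound ω (2 * l) B g) (hg' : DecayBound ω (2 * l) B (𝓕 g)) (x ξ : Rd d) :
    ‖normStft g f x ξ‖ ≤ A * B * (∫ y : Rd d, Real.exp (-(1 * ω ‖y‖))) *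
      Real.exp (-(l * (ω ‖x‖ + ω ‖ξ‖))) := by
  have hA := hf.nonneg
  have hB := hg.nonneg
  have hI : 0 ≤ ∫ y : Rd d, Real.exp (-(1 * ω ‖y‖)) :=
    MeasureTheory.integral_nonneg fun _ => Real.exp_nonneg _
  have h1 := norm_normStft_le hω (by positivity) hf hg x ξ
  have h2 := norm_normStft_le hω (by positivity) hf' hg' ξ (-x)
  rw [← norm_normStft_fourier hfi hgc hgi hgi'] at h2
  -- The estimate in the variable of larger weight is kept: twice the maximum dominates the sum.
  rcases le_total (ω ‖x‖) (ω ‖ξ‖) with h | h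
  · refine h2.trans (mul_le_mul_of_nonneg_left (Real.exp_le_exp.2 ?_) (by positivity))
    nlinarith
  · refine h1.trans (mul_le_mul_of_nonneg_left (Real.exp_le_exp.2 ?_) (by positivity))
    nlinarith

lemma integrable_mul_conj_schwartz {d : ℕ} (f φ : 𝓢(Rd d, ℂ)) (x : Rd d) :
    MeasureTheory.Integrable fun y => f y * (starRingEnd ℂ) (φ (y - x)) := by
  obtain ⟨C, hC⟩ := φ.decay 0 0
  refine f.integrable.mul_bdd (c := C) ?_ (.of_forall fun y => ?_)
  · exact (Complex.continuous_conj.comp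
      (φ.continuous.comp (continuous_id.sub continuous_const))).aestronglyMeasurable
  · rw [RCLike.norm_conj]
    simpa using hC.2 (y - x)

/-- Fourier inversion in the frequency variable recovers `f` from its short-time Fourier
transform. -/
lemma norm_mul_norm_le_of_normStft_le {d : ℕ} {ω : ℝ → ℝ} (hω : IsWeight ω) {l B : ℝ}
    (hl : 0 ≤ l) (hB : 0 ≤ B) (f φ : 𝓢(Rd d, ℂ))
    (h : ∀ x ξ, ‖normStft φ f x ξ‖ ≤ B * Real.exp (-(l * ω ‖x‖)) * Real.exp (-(1 * ω ‖ξ‖)))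
    (w y : Rd d) :
    ‖f y‖ * ‖φ w‖ ≤ B * (∫ ξ : Rd d, Real.exp (-(1 * ω ‖ξ‖))) * Real.exp (l * ω ‖w‖) *
      Real.exp (-(l * ω ‖y‖)) := by
  -- With this x the window takes the constant value φ(w) at y, so inversion at y isolates f(y).
  set x := y - w with hx
  set H : Rd d → ℂ := fun v => f v * (starRingEnd ℂ) (φ (v - x)) with hH
  have hHc : Continuous H := f.continuous.mul (Complex.continuous_conj.comp
      (φ.continuous.comp (continuous_id.sub continuous_const)))
  have hHi : MeasureTheory.Integrable H := integrable_mul_conj_schwartz f φ x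
  have hFc : Continuous (𝓕 H) :=
    VectorFourier.fourierIntegral_continuous Real.continuous_fourierChar continuous_inner hHi
  have hbi := (hω.integrable_exp_neg (d := d) one_pos).const_mul (B * Real.exp (-(l * ω ‖x‖)))
  have hFi : MeasureTheory.Integrable (𝓕 H) :=
    hbi.mono' hFc.aestronglyMeasurable (.of_forall fun ξ => h x ξ)
  have h1 : f y * (starRingEnd ℂ) (φ w) = ∫ ξ, Real.fourierChar (inner ℝ ξ y) • 𝓕 H ξ := by
    rw [← Real.fourierInv_eq, hHc.fourierInv_fourier_eq hHi hFi]
    simp [hH, hx]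
  have h2 : ‖f y‖ * ‖φ w‖ ≤ ∫ ξ : Rd d,
      B * Real.exp (-(l * ω ‖x‖)) * Real.exp (-(1 * ω ‖ξ‖)) := by
    rw [← RCLike.norm_conj (φ w), ← norm_mul, h1]
    refine MeasureTheory.norm_integral_le_of_norm_le hbi (.of_forall fun ξ => ?_)
    rw [Circle.norm_smul]
    exact h x ξ
  rw [MeasureTheory.integral_const_mul] at h2
  refine h2.trans ?_
  have hI : 0 ≤ ∫ y : Rd d, Real.exp (-(1 * ω ‖y‖)) :=
    MeasureTheory.integral_nonneg fun _ => Real.exp_nonneg _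
  calc B * Real.exp (-(l * ω ‖x‖)) * ∫ ξ : Rd d, Real.exp (-(1 * ω ‖ξ‖))
      ≤ B * Real.exp (l * ω ‖w‖ + -(l * ω ‖y‖)) * ∫ ξ : Rd d, Real.exp (-(1 * ω ‖ξ‖)) := by
        gcongr
        have h3 := hω.add_norm_le y x
        have h4 : x - y = -w := by rw [hx]; abel
        rw [h4, norm_neg] at h3
        nlinarith
    _ = _ := by rw [Real.exp_add]; ring

/-- Decay of the short-time Fourier transform gives decay of `f` and of `𝓕 f`. -/
lemma exists_decayBound_of_normStft_le {d : ℕ} {ω : ℝ → ℝ} (hω : IsWeight ω) {l : ℝ}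
    (hl : 0 ≤ l) {φ : 𝓢(Rd d, ℂ)} (hφ : φ ≠ 0) :
    ∃ C, 0 < C ∧ ∀ (f : 𝓢(Rd d, ℂ)) (B : ℝ), 0 ≤ B →
      (∀ x ξ, ‖normStft φ f x ξ‖ ≤ B * Real.exp (-((l + 1) * (ω ‖x‖ + ω ‖ξ‖)))) →
      DecayBound ω l (C * B) f ∧ DecayBound ω l (C * B) (𝓕 (f : Rd d → ℂ)) := by
  have hex : ∀ ψ : 𝓢(Rd d, ℂ), ψ ≠ 0 → ∃ C, 0 ≤ C ∧ ∀ (f : 𝓢(Rd d, ℂ)) (B : ℝ), 0 ≤ B →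
      (∀ x ξ, ‖normStft ψ f x ξ‖ ≤ B * Real.exp (-((l + 1) * (ω ‖x‖ + ω ‖ξ‖)))) →
      DecayBound ω l (C * B) f := by
    intro ψ hψ
    obtain ⟨w, hw⟩ : ∃ w, ψ w ≠ 0 := by
      by_contra! h
      exact hψ (by ext x; simpa using h x)
    have hw0 : 0 < ‖ψ w‖ := norm_pos_iff.2 hw
    have hI : 0 ≤ ∫ y : Rd d, Real.exp (-(1 * ω ‖y‖)) :=
      MeasureTheory.integral_nonneg fun _ => Real.exp_nonneg _
    refine ⟨(∫ ξ : Rd d, Real.exp (-(1 * ω ‖ξ‖))) * Real.exp (l * ω ‖w‖) / ‖ψ w‖, by positivity,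
      fun f B hB h y => ?_⟩
    have h1 := norm_mul_norm_le_of_normStft_le hω hl hB f ψ (fun x ξ => (h x ξ).trans ?_) w y
    · rw [← le_div_iff₀ hw0] at h1
      refine h1.trans (le_of_eq ?_)
      ring
    · rw [mul_assoc, ← Real.exp_add]
      gcongr
      have h2 := hω.nonneg _ (norm_nonneg x)
      have h3 := hω.nonneg _ (norm_nonneg ξ)
      nlinarith
  obtain ⟨C₁, h₁, H₁⟩ := hex φ hφ
  have hφ' : 𝓕 φ ≠ 0 := by
    intro h
    apply hφ
    have h1 : 𝓕⁻ (𝓕 φ) = φ := FourierTransform.fourierInv_fourier_eq φ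
    rw [← h1, h]
    exact FourierTransform.fourierInv_zero
  obtain ⟨C₂, h₂, H₂⟩ := hex (𝓕 φ) hφ'
  refine ⟨C₁ + C₂ + 1, by positivity, fun f B hB h => ⟨fun y => ?_, fun y => ?_⟩⟩
  · refine (H₁ f B hB h y).trans ?_
    gcongr
    linarith
  -- The first half applied to 𝓕 f with window 𝓕 φ, the hypothesis being carried over by the
  -- rotation of phase space in `norm_normStft_fourier`.
  · have h3 := H₂ (𝓕 f) B hB (fun ξ x => ?_) y
    · rw [SchwartzMap.fourier_coe] at h3
      refine h3.trans ?_
      gcongr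
      linarith
    · have h4 := h (-x) ξ
      rw [norm_normStft_fourier f.integrable φ.continuous φ.integrable (𝓕 φ).integrable,
        neg_neg, norm_neg, add_comm (ω ‖x‖)] at h4
      exact h4

/-! ### Gaussian localisation and bounds on derivatives. -/

/-- The Gaussian `e^{-π|w|²}`. -/
def gauss (d : ℕ) (w : Rd d) : ℂ := Complex.exp (-(Real.pi : ℂ) * (‖w‖ : ℂ) ^ 2)

/-- The reciprocal `e^{π|w|²}` of the Gaussian. -/
def gaussInv (d : ℕ) (w : Rd d) : ℂ := Complex.exp ((Real.pi : ℂ) * ((‖w‖ ^ 2 : ℝ) : ℂ))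

lemma gauss_mul_gaussInv {d : ℕ} (w : Rd d) : gauss d w * gaussInv d w = 1 := by
  rw [gauss, gaussInv, ← Complex.exp_add, Complex.exp_eq_one_iff]
  exact ⟨0, by push_cast; ring⟩

lemma conj_gauss {d : ℕ} (w : Rd d) : (starRingEnd ℂ) (gauss d w) = gauss d w := by
  rw [gauss, ← Complex.exp_conj]
  simp [Complex.conj_ofReal]

lemma continuous_gauss (d : ℕ) : Continuous (gauss d) := by
  unfold gauss; fun_prop

lemma fourier_gauss (d : ℕ) : 𝓕 (gauss d) = gauss d := by
  have hpi : (Real.pi : ℂ) ≠ 0 := by exact_mod_cast Real.pi_ne_zero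
  funext w
  have h := fourier_gaussian_innerProductSpace (V := Rd d) (b := (Real.pi : ℂ))
    (by simpa using Real.pi_pos) w
  unfold gauss
  rw [h, div_self hpi, Complex.one_cpow, one_mul]
  congr 1
  field_simp

lemma contDiff_gaussInv (d : ℕ) (n : WithTop ℕ∞) : ContDiff ℝ n (gaussInv d) := by
  unfold gaussInv
  exact Complex.contDiff_exp.comp (contDiff_const.mul
    (Complex.ofRealCLM.contDiff.comp (contDiff_norm_sq ℝ)))

lemma exists_decayBound_gauss {ω : ℝ → ℝ} (hω : IsWeight ω) (d : ℕ) {l : ℝ} (hl : 0 < l) :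
    ∃ B, DecayBound ω l B (gauss d) := by
  obtain ⟨C, hC0, hC⟩ := hω.exists_le_mul_add (ε := l⁻¹) (by positivity)
  refine ⟨Real.exp (1 + l * C), fun x => ?_⟩
  rw [gauss, Complex.norm_exp, ← Real.exp_add]
  apply Real.exp_le_exp.2
  have h1 := mul_le_mul_of_nonneg_left (hC ‖x‖ (norm_nonneg x)) hl.le
  have h2 : l * (l⁻¹ * ‖x‖ + C) = ‖x‖ + l * C := by field_simp
  have h3 : (-(Real.pi : ℂ) * (‖x‖ : ℂ) ^ 2).re = -(Real.pi * ‖x‖ ^ 2) := by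
    rw [show -(Real.pi : ℂ) * (‖x‖ : ℂ) ^ 2 = ((-(Real.pi * ‖x‖ ^ 2) : ℝ) : ℂ) by push_cast; ring,
      Complex.ofReal_re]
  rw [h3]
  nlinarith [Real.pi_gt_three, sq_nonneg (‖x‖ - 1), norm_nonneg x,
    mul_le_mul_of_nonneg_right Real.pi_gt_three.le (sq_nonneg ‖x‖)]

lemma DecayBound.integrable {ω : ℝ → ℝ} (hω : IsWeight ω) {d : ℕ} {l B : ℝ} (hl : 0 < l)
    {f : Rd d → ℂ} (hf : DecayBound ω l B f) (hc : Continuous f) : MeasureTheory.Integrable f :=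
  ((hω.integrable_exp_neg hl).const_mul B).mono' hc.aestronglyMeasurable (.of_forall hf)

/-- The derivatives of an analytic function at a point grow at most like `C a^n n!`. -/
lemma exists_norm_iteratedFDeriv_le_of_analyticAt {E F : Type*} [NormedAddCommGroup E]
    [NormedSpace ℝ E] [NormedAddCommGroup F] [NormedSpace ℝ F] [CompleteSpace F] {f : E → F}
    {x : E} (hf : AnalyticAt ℝ f x) :
    ∃ C a : ℝ, 0 < C ∧ 0 < a ∧ ∀ n : ℕ, ‖iteratedFDeriv ℝ n f x‖ ≤ C * (a ^ n * n.factorial) := by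
  obtain ⟨p, r, hp⟩ := hf
  obtain ⟨ρ, hρ0, hρ⟩ := ENNReal.lt_iff_exists_nnreal_btwn.1 (hp.r_pos.trans_le hp.r_le)
  have hρ0' : 0 < ρ := by exact_mod_cast hρ0
  obtain ⟨C, hC, hpC⟩ := p.norm_le_div_pow_of_pos_of_lt_radius hρ0' hρ
  have hρr : (0 : ℝ) < ρ := hρ0'
  refine ⟨C, (ρ : ℝ)⁻¹, hC, inv_pos.2 hρr, fun n => ?_⟩
  refine ContinuousMultilinearMap.opNorm_le_bound (by positivity) fun v => ?_
  -- The n-th derivative is the sum over all permutations of the n-th Taylor term; this produces the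
  -- n!.
  rw [hp.iteratedFDeriv_eq_sum_of_completeSpace]
  refine (norm_sum_le _ _).trans ?_
  calc ∑ σ : Equiv.Perm (Fin n), ‖p n fun i => v (σ i)‖
      ≤ ∑ _σ : Equiv.Perm (Fin n), C / (ρ : ℝ) ^ n * ∏ i, ‖v i‖ := by
        refine Finset.sum_le_sum fun σ _ => ((p n).le_opNorm _).trans ?_
        rw [Equiv.prod_comp σ fun i => ‖v i‖]
        gcongr
        exact hpC n
    _ = _ := by
        rw [Finset.sum_const, Finset.card_univ, Fintype.card_perm, Fintype.card_fin, nsmul_eq_mul]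
        rw [inv_pow]; field_simp

/-- Weighted decay of the Fourier transform bounds all derivatives. -/
lemma contDiff_and_norm_iteratedFDeriv_le {ω : ℝ → ℝ} (hω : IsWeight ω) {d : ℕ} {l M : ℝ}
    (hl : 0 < l) {H : Rd d → ℂ} (hc : Continuous H) (hi : MeasureTheory.Integrable H)
    (hH : DecayBound ω (l + 1) M (𝓕 H)) :
    ContDiff ℝ (⊤ : ℕ∞) H ∧ ∀ (n : ℕ) (y : Rd d), ‖iteratedFDeriv ℝ n H y‖ ≤
      Real.exp (l * ω 1) * (∫ ξ : Rd d, Real.exp (-(1 * ω ‖ξ‖))) * M *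
        ((2 * Real.pi) ^ n * Real.exp (l * youngConj ω (n / l))) := by
  have hM := hH.nonneg
  have hFc : Continuous (𝓕 H) :=
    VectorFourier.fourierIntegral_continuous Real.continuous_fourierChar continuous_inner hi
  have hFi : MeasureTheory.Integrable (𝓕 H) := hH.integrable hω (by positivity) hFc
  -- The reflection makes H a forward Fourier transform, whose derivatives are transforms of K times
  -- powers of v.
  set K : Rd d → ℂ := fun ξ => 𝓕 H (-ξ) with hK
  have hKc : Continuous K := hFc.comp continuous_neg
  have hKb : DecayBound ω (l + 1) M K := fun ξ => by simpa using hH (-ξ)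
  have hHK : H = 𝓕 K := by
    rw [← Real.fourierInv_eq_fourier_comp_neg, hc.fourierInv_fourier_eq hi hFi]
  have hKi : ∀ n : ℕ, (n : ℕ∞) ≤ ⊤ → MeasureTheory.Integrable fun v => ‖v‖ ^ n * ‖K v‖ := by
    intro n _
    have h1 := (hω.integrable_pow_mul_exp_neg (d := d) (k := l + 1) (by positivity) n).const_mul M
    refine h1.mono' ((continuous_norm.pow n).mul hKc.norm).aestronglyMeasurable
      (.of_forall fun v => ?_)
    rw [Real.norm_of_nonneg (by positivity)]
    calc ‖v‖ ^ n * ‖K v‖ ≤ ‖v‖ ^ n * (M * Real.exp (-((l + 1) * ω ‖v‖))) := by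
          gcongr; exact hKb v
      _ = _ := by ring
  refine ⟨hHK ▸ Real.contDiff_fourier hKi, fun n y => ?_⟩
  rw [hHK, Real.iteratedFDeriv_fourier hKi hKc.aestronglyMeasurable le_top, Real.fourier_eq]
  have hbi := (hω.integrable_exp_neg (d := d) one_pos).const_mul
    (Real.exp (l * ω 1) * M * ((2 * Real.pi) ^ n * Real.exp (l * youngConj ω (n / l))))
  refine (MeasureTheory.norm_integral_le_of_norm_le hbi (.of_forall fun v => ?_)).trans ?_
  · rw [Circle.norm_smul]
    refine (VectorFourier.norm_fourierPowSMulRight_le _ K v n).trans ?_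
    have h1 := hω.pow_mul_exp_neg_le hl n (norm_nonneg v)
    have h2 : ‖(innerSL ℝ : Rd d →L[ℝ] Rd d →L[ℝ] ℝ)‖ ≤ 1 := norm_innerSL_le ℝ
    calc (2 * Real.pi * ‖(innerSL ℝ : Rd d →L[ℝ] Rd d →L[ℝ] ℝ)‖) ^ n * ‖v‖ ^ n * ‖K v‖
        ≤ (2 * Real.pi * 1) ^ n * ‖v‖ ^ n * (M * Real.exp (-((l + 1) * ω ‖v‖))) := by
          gcongr; exact hKb v
      _ = M * (2 * Real.pi) ^ n * (‖v‖ ^ n * Real.exp (-(l * ω ‖v‖))) *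
            Real.exp (-(1 * ω ‖v‖)) := by
          rw [show -((l + 1) * ω ‖v‖) = -(l * ω ‖v‖) + -(1 * ω ‖v‖) by ring, Real.exp_add]
          ring
      _ ≤ M * (2 * Real.pi) ^ n * (Real.exp (l * ω 1) * Real.exp (l * youngConj ω (n / l))) *
            Real.exp (-(1 * ω ‖v‖)) := by gcongr
      _ = _ := by ring
  · rw [MeasureTheory.integral_const_mul]
    apply le_of_eq; ring

/-- Weighted decay of `f` and of `𝓕 f` bounds all derivatives of `f`, with weighted decay. -/
lemma exists_norm_iteratedFDeriv_le {ω : ℝ → ℝ} (hω : IsWeight ω) (d : ℕ) {l m : ℝ}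
    (hl : 0 < l) (hm : 0 < m) :
    ∃ C L : ℝ, 0 < C ∧ 0 < L ∧ ∀ (f : 𝓢(Rd d, ℂ)) (B : ℝ), DecayBound ω L B f →
      DecayBound ω L B (𝓕 (f : Rd d → ℂ)) → ∀ (n : ℕ) (y : Rd d), ‖iteratedFDeriv ℝ n f y‖ ≤
        C * B * (Real.exp (l * youngConj ω (n / l)) * Real.exp (-(m * ω ‖y‖))) := by
  have hana : AnalyticAt ℝ (gaussInv d) 0 :=
    contDiff_omega_iff_analyticOnNhd.1 (contDiff_gaussInv d ⊤) 0 (Set.mem_univ _)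
  obtain ⟨C₁, a, hC₁, ha, hga⟩ := exists_norm_iteratedFDeriv_le_of_analyticAt hana
  -- Leibniz will contribute 2^n and Fourier differentiation (2π)^n; since 4π ≤ 13, the passage from
  -- l' = 13 l to l absorbs both.
  set l' : ℝ := (13 : ℕ) * l with hl'
  have hl'0 : 0 < l' := by positivity
  obtain ⟨C₂, hC₂, hfac⟩ := hω.exists_factorial_le ha hl'0
  set p : ℝ := max m (l' + 1) with hp
  have hpm : m ≤ p := le_max_left _ _
  have hpl : l' + 1 ≤ p := le_max_right _ _
  have hp0 : 0 < p := by linarith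
  obtain ⟨G, hG⟩ := exists_decayBound_gauss hω d (l := 2 * p) (by positivity)
  have hG0 := hG.nonneg
  set I := ∫ ξ : Rd d, Real.exp (-(1 * ω ‖ξ‖)) with hI
  have hI0 : 0 ≤ I := MeasureTheory.integral_nonneg fun _ => Real.exp_nonneg _
  -- The `+ 1` secures a positive constant, G and I being known only to be nonnegative.
  refine ⟨C₁ * C₂ * (Real.exp (l' * ω 1) * I) * (G * I) + 1, 2 * p + 1, by positivity, by positivity,
    fun f B hf hf' n y => ?_⟩
  have hB := hf.nonneg
  have hgi : MeasureTheory.Integrable (gauss d) :=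
    hG.integrable hω (by positivity) (continuous_gauss d)
  set H : Rd d → ℂ := fun v => f v * (starRingEnd ℂ) (gauss d (v - y)) with hH
  have hHc : Continuous H := f.continuous.mul (Complex.continuous_conj.comp
    ((continuous_gauss d).comp (continuous_id.sub continuous_const)))
  have hHi : MeasureTheory.Integrable H := by
    refine f.integrable.mul_bdd (c := G) ?_ (.of_forall fun v => ?_)
    · exact (Complex.continuous_conj.comp ((continuous_gauss d).comp
        (continuous_id.sub continuous_const))).aestronglyMeasurable
    · rw [RCLike.norm_conj]
      refine (hG _).trans (mul_le_of_le_one_right hG0 (Real.exp_le_one_iff.2 ?_))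
      have := hω.nonneg _ (norm_nonneg (v - y))
      have : 0 ≤ 2 * p * ω ‖v - y‖ := by positivity
      linarith
  -- 𝓕 H at ξ is the short-time Fourier transform of f at (y, ξ) with Gaussian window. Rate p in
  -- both variables is split into m in y and l' + 1 in ξ.
  have hHb : DecayBound ω (l' + 1) (B * G * I * Real.exp (-(m * ω ‖y‖))) (𝓕 H) := by
    intro ξ
    refine (norm_normStft_le_phase hω hp0.le f.integrable (continuous_gauss d) hgi
      (by rwa [fourier_gauss]) hf hf' hG (by rwa [fourier_gauss]) y ξ).trans ?_
    rw [← hI, mul_assoc _ (Real.exp _), ← Real.exp_add]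
    refine mul_le_mul_of_nonneg_left (Real.exp_le_exp.2 ?_) (by positivity)
    have h1 := mul_le_mul_of_nonneg_right hpm (hω.nonneg _ (norm_nonneg y))
    have h2 := mul_le_mul_of_nonneg_right hpl (hω.nonneg _ (norm_nonneg ξ))
    linarith
  obtain ⟨hHs, hHd⟩ := contDiff_and_norm_iteratedFDeriv_le hω hl'0 hHc hHi hHb
  have hfe : (f : Rd d → ℂ) = fun v => H v * gaussInv d (v - y) := by
    funext v
    rw [hH]
    simp only
    rw [conj_gauss, mul_assoc, gauss_mul_gaussInv, mul_one]
  have hEs : ContDiff ℝ (⊤ : ℕ∞) fun v => gaussInv d (v - y) :=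
    (contDiff_gaussInv d _).comp (contDiff_id.sub contDiff_const)
  rw [hfe]
  refine (norm_iteratedFDeriv_mul_le hHs hEs y (n := n) (by exact_mod_cast le_top)).trans ?_
  set S : ℝ := C₁ * C₂ * (Real.exp (l' * ω 1) * I) * (G * I) * B * Real.exp (-(m * ω ‖y‖)) with hS
  have hS0 : 0 ≤ S := by positivity
  have hterm : ∀ i ∈ Finset.range (n + 1),
      (n.choose i : ℝ) * ‖iteratedFDeriv ℝ i H y‖ *
        ‖iteratedFDeriv ℝ (n - i) (fun v => gaussInv d (v - y)) y‖ ≤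
      n.choose i * (S * ((2 * Real.pi) ^ n * Real.exp (l' * youngConj ω (n / l')))) := by
    intro i hi
    have hin : i ≤ n := Nat.lt_succ_iff.1 (Finset.mem_range.1 hi)
    -- At the centre y the reciprocal Gaussian is differentiated at 0, so its bounds do not depend
    -- on y.
    rw [iteratedFDeriv_comp_sub, sub_self, mul_assoc]
    refine mul_le_mul_of_nonneg_left ?_ (Nat.cast_nonneg _)
    have h1 := hHd i y
    have h2 := (hga (n - i)).trans (mul_le_mul_of_nonneg_left (hfac (n - i)) hC₁.le)
    have h3 : Real.exp (l' * youngConj ω (i / l')) *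
        Real.exp (l' * youngConj ω ((n - i : ℕ) / l')) ≤ Real.exp (l' * youngConj ω (n / l')) := by
      rw [← Real.exp_add, ← mul_add]
      apply Real.exp_le_exp.2
      gcongr
      refine (hω.youngConj_add_le (by positivity) (by positivity)).trans (le_of_eq ?_)
      rw [Nat.cast_sub hin]
      congr 1; ring
    have h4 : (2 * Real.pi) ^ i ≤ (2 * Real.pi) ^ n :=
      pow_le_pow_right₀ (by linarith [Real.pi_gt_three]) hin
    calc ‖iteratedFDeriv ℝ i H y‖ * ‖iteratedFDeriv ℝ (n - i) (gaussInv d) 0‖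
        ≤ (Real.exp (l' * ω 1) * I * (B * G * I * Real.exp (-(m * ω ‖y‖))) *
            ((2 * Real.pi) ^ i * Real.exp (l' * youngConj ω (i / l')))) *
          (C₁ * (C₂ * Real.exp (l' * youngConj ω ((n - i : ℕ) / l')))) := by gcongr
      _ = S * ((2 * Real.pi) ^ i * (Real.exp (l' * youngConj ω (i / l')) *
            Real.exp (l' * youngConj ω ((n - i : ℕ) / l')))) := by rw [hS]; ring
      _ ≤ _ := by gcongr
  refine (Finset.sum_le_sum hterm).trans ?_
  rw [← Finset.sum_mul]
  have hsum : ∑ i ∈ Finset.range (n + 1), (n.choose i : ℝ) = 2 ^ n := by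
    exact_mod_cast Nat.sum_range_choose n
  rw [hsum]
  have h5 := hω.pow_mul_exp_youngConj_le (K := 13) (by norm_num) (a := 4 * Real.pi)
    (by linarith [Real.pi_gt_three]) (by norm_num; linarith [Real.pi_lt_d2]) hl n
  calc (2 : ℝ) ^ n * (S * ((2 * Real.pi) ^ n * Real.exp (l' * youngConj ω (n / l'))))
      = S * ((4 * Real.pi) ^ n * Real.exp (l' * youngConj ω (n / l'))) := by
        rw [show 4 * Real.pi = 2 * (2 * Real.pi) by ring, mul_pow 2 (2 * Real.pi)]; ring
    _ ≤ S * Real.exp (l * youngConj ω (n / l)) := by gcongr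
    _ ≤ (S + B * Real.exp (-(m * ω ‖y‖))) * Real.exp (l * youngConj ω (n / l)) := by
        gcongr
        have : 0 ≤ B * Real.exp (-(m * ω ‖y‖)) := by positivity
        linarith
    _ = _ := by rw [hS]; ring

/-! ### Multi-indices -/

/-- Each partial derivative fills one slot of the iterated derivative with a unit basis vector, so
the operator norm controls every multi-index derivative. -/
lemma exists_foldr_pderiv_eq {d : ℕ} {g : Rd d → ℂ} (hg : ContDiff ℝ (⊤ : ℕ∞) g)
    (α : Fin d → ℕ) (l : List (Fin d)) :
    ∃ v : Fin (l.map α).sum → Rd d, (∀ i, ‖v i‖ = 1) ∧ ∀ x,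
      l.foldr (fun j h => (pderiv j)^[α j] h) g x = iteratedFDeriv ℝ (l.map α).sum g x v := by
  have step : ∀ (j : Fin d) (k m : ℕ) (h : Rd d → ℂ) (v : Fin m → Rd d), (∀ i, ‖v i‖ = 1) →
      (∀ x, h x = iteratedFDeriv ℝ m g x v) → ∃ w : Fin (k + m) → Rd d, (∀ i, ‖w i‖ = 1) ∧
        ∀ x, (pderiv j)^[k] h x = iteratedFDeriv ℝ (k + m) g x w := by
    intro j k m h v hv hh
    induction k with
    | zero => rw [Nat.zero_add]; exact ⟨v, hv, hh⟩
    | succ k ih =>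
      obtain ⟨w, hw, hw'⟩ := ih
      rw [Nat.add_right_comm]
      refine ⟨Fin.cons (EuclideanSpace.single j 1) w, fun i => ?_, fun x => ?_⟩
      · refine Fin.cases ?_ (fun i => ?_) i
        · simp
        · simpa using hw i
      · have hd : DifferentiableAt ℝ (iteratedFDeriv ℝ (k + m) g) x :=
          (hg.differentiable_iteratedFDeriv (by exact_mod_cast ENat.natCast_lt_top _)) x
        rw [Function.iterate_succ_apply', iteratedFDeriv_succ_apply_left, pderiv, funext hw',
          fderiv_continuousMultilinear_apply_const_apply hd]
        simp
  induction l with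
  | nil =>
    rw [List.map_nil, List.sum_nil]
    exact ⟨Fin.elim0, fun i => i.elim0, fun x => by simp⟩
  | cons j l ih =>
    obtain ⟨v, hv, hv'⟩ := ih
    rw [List.map_cons, List.sum_cons]
    exact step j (α j) _ _ v hv hv'

lemma norm_multiDeriv_le {d : ℕ} {g : Rd d → ℂ} (hg : ContDiff ℝ (⊤ : ℕ∞) g) (α : Fin d → ℕ)
    (x : Rd d) : ‖multiDeriv α g x‖ ≤ ‖iteratedFDeriv ℝ (∑ j, α j) g x‖ := by
  obtain ⟨v, hv, h⟩ := exists_foldr_pderiv_eq hg α (List.finRange d)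
  rw [Fin.sum_univ_def, multiDeriv, h x]
  refine (ContinuousMultilinearMap.le_opNorm _ _).trans ?_
  simp [hv]

lemma norm_multiD {d : ℕ} (α : Fin d → ℕ) (g : Rd d → ℂ) (x : Rd d) :
    ‖multiD α g x‖ = ‖multiDeriv α g x‖ := by
  simp [multiD]

lemma abs_prod_pow_le {d : ℕ} (x : Rd d) (β : Fin d → ℕ) :
    |∏ j, x j ^ β j| ≤ ‖x‖ ^ ∑ j, β j := by
  rw [Finset.abs_prod, ← Finset.prod_pow_eq_pow_sum]
  refine Finset.prod_le_prod (fun _ _ => abs_nonneg _) fun j _ => ?_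
  rw [abs_pow]
  gcongr
  exact PiLp.norm_apply_le x j

/-- Weighted decay of `f` and of `𝓕 f` bounds the seminorms `p_{l,m}`. -/
lemma exists_pSup_le {ω : ℝ → ℝ} (hω : IsWeight ω) (d : ℕ) {l m : ℝ} (hl : 0 < l) (hm : 0 < m) :
    ∃ C L : ℝ, 0 < C ∧ 0 < L ∧ ∀ (f : 𝓢(Rd d, ℂ)) (B : ℝ), DecayBound ω L B f →
      DecayBound ω L B (𝓕 (f : Rd d → ℂ)) → pSup ω l m f ≤ ENNReal.ofReal (C * B) := by
  obtain ⟨C, L, hC, hL, h⟩ := exists_norm_iteratedFDeriv_le hω d hl hm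
  refine ⟨C * Real.exp (m * ω 1), L, by positivity, hL, fun f B hf hf' => ?_⟩
  have hB := hf.nonneg
  refine iSup_le fun α => iSup_le fun β => iSup_le fun x => ENNReal.ofReal_le_ofReal ?_
  rw [norm_mul, norm_multiD, Complex.norm_real, Real.norm_eq_abs]
  have h1 := (norm_multiDeriv_le (f.smooth ⊤) α x).trans (h f B hf hf' _ x)
  have h2 := hω.pow_mul_exp_neg_le hm (∑ j, β j) (norm_nonneg x)
  set a := l * youngConj ω (((∑ j, α j : ℕ) : ℝ) / l)
  set b := m * youngConj ω (((∑ j, β j : ℕ) : ℝ) / m)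
  calc |∏ j, x j ^ β j| * ‖multiDeriv α f x‖ * Real.exp (-a - b)
      ≤ ‖x‖ ^ (∑ j, β j) * (C * B * (Real.exp a * Real.exp (-(m * ω ‖x‖)))) *
          Real.exp (-a - b) := by
        gcongr
        exact abs_prod_pow_le x β
    _ = C * B * (‖x‖ ^ (∑ j, β j) * Real.exp (-(m * ω ‖x‖))) *
          (Real.exp a * Real.exp (-a - b)) := by ring
    _ ≤ C * B * (Real.exp (m * ω 1) * Real.exp b) * (Real.exp a * Real.exp (-a - b)) := by
        gcongr
    _ = C * B * Real.exp (m * ω 1) * (Real.exp b * (Real.exp a * Real.exp (-a - b))) := by ring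
    _ = _ := by
        rw [← Real.exp_add, ← Real.exp_add, show b + (a + (-a - b)) = 0 by ring, Real.exp_zero]
        ring

/-! ### From the seminorms `p` back to decay. -/

lemma foldr_iterate_single {d : ℕ} (j : Fin d) (n : ℕ) (g : Rd d → ℂ) {l : List (Fin d)}
    (hl : l.Nodup) :
    l.foldr (fun i h => (pderiv i)^[(Pi.single j n : Fin d → ℕ) i] h) g =
      if j ∈ l then (pderiv j)^[n] g else g := by
  induction l with
  | nil => simp
  | cons i l ih =>
    rw [List.nodup_cons] at hl
    rw [List.foldr_cons, ih hl.2]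
    rcases eq_or_ne i j with rfl | h
    · simp [hl.1]
    · simp [h, h.symm]

lemma multiDeriv_single {d : ℕ} (j : Fin d) (n : ℕ) (g : Rd d → ℂ) :
    multiDeriv (Pi.single j n) g = (pderiv j)^[n] g := by
  rw [multiDeriv, foldr_iterate_single j n g (List.nodup_finRange d)]
  simp

lemma multiDeriv_zero {d : ℕ} (g : Rd d → ℂ) : multiDeriv 0 g = g := by
  have key : ∀ l : List (Fin d),
      l.foldr (fun i h => (pderiv i)^[(0 : Fin d → ℕ) i] h) g = g := by
    intro l
    induction l with
    | nil => rfl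
    | cons i l ih => rw [List.foldr_cons, ih]; rfl
  exact key _

lemma exists_schwartz_iterate_pderiv {d : ℕ} (f : 𝓢(Rd d, ℂ)) (j : Fin d) (n : ℕ) :
    ∃ g : 𝓢(Rd d, ℂ), (g : Rd d → ℂ) = (pderiv j)^[n] f ∧
      ∀ ξ, 𝓕 (g : Rd d → ℂ) ξ = (2 * Real.pi * Complex.I * (ξ j : ℂ)) ^ n * 𝓕 (f : Rd d → ℂ) ξ := by
  induction n with
  | zero => exact ⟨f, rfl, fun ξ => by simp⟩
  | succ n ih =>
    obtain ⟨g, hg, hg'⟩ := ih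
    refine ⟨LineDeriv.lineDerivOp (EuclideanSpace.single j (1 : ℝ)) g, ?_, fun ξ => ?_⟩
    · funext x
      rw [Function.iterate_succ_apply', ← hg, pderiv]
      exact SchwartzMap.lineDerivOp_apply_eq_fderiv _ g x
    · have hT : (fun x : Rd d => inner ℝ x (EuclideanSpace.single j (1 : ℝ))).HasTemperateGrowth :=
        ((innerSL ℝ).flip (EuclideanSpace.single j (1 : ℝ))).hasTemperateGrowth
      rw [← SchwartzMap.fourier_coe, SchwartzMap.fourier_lineDerivOp_eq]
      rw [smul_apply, SchwartzMap.smulLeftCLM_apply_apply hT,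
        SchwartzMap.fourier_coe, hg' ξ, EuclideanSpace.inner_single_right]
      simp only [one_mul, conj_trivial, Complex.real_smul, smul_eq_mul]
      ring

lemma exists_norm_le_mul_abs {d : ℕ} (x : Rd d) (hx : (d : ℝ) < ‖x‖) :
    ∃ j, ‖x‖ ≤ d * |x j| := by
  by_contra! h
  have h0 : 0 < ‖x‖ := lt_of_le_of_lt (Nat.cast_nonneg d) hx
  have h1 : ‖x‖ ≤ ∑ j, |x j| := by
    rw [EuclideanSpace.norm_eq]
    apply Real.sqrt_le_iff.2
    refine ⟨Finset.sum_nonneg fun _ _ => abs_nonneg _, ?_⟩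
    exact Finset.sum_sq_le_sq_sum_of_nonneg fun _ _ => abs_nonneg _
  rcases Nat.eq_zero_or_pos d with rfl | hd
  · simp at h1; simp [h1] at h0
  · have hd0 : (0 : ℝ) < d := by exact_mod_cast hd
    have : Nonempty (Fin d) := ⟨⟨0, hd⟩⟩
    have h2 : ∑ j, (d : ℝ) * |x j| < ∑ _j : Fin d, ‖x‖ :=
      Finset.sum_lt_sum_of_nonempty Finset.univ_nonempty fun j _ => h j
    rw [← Finset.mul_sum, Finset.sum_const, Finset.card_univ, Fintype.card_fin,
      nsmul_eq_mul] at h2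
    nlinarith

/-- Coordinatewise moment bounds governed by the Young conjugate give weighted decay. -/
lemma exists_le_of_moments {ω : ℝ → ℝ} (hω : IsWeight ω) (d : ℕ) {l : ℝ} (hl : 0 < l) :
    ∃ C m : ℝ, 0 < C ∧ 0 < m ∧ ∀ (G B : ℝ) (x : Rd d), 0 ≤ B → G ≤ B →
      (∀ (j : Fin d) (n : ℕ), |x j| ^ n * G ≤ B * Real.exp (m * youngConj ω (n / m))) →
      G ≤ C * B * Real.exp (-(l * ω ‖x‖)) := by
  obtain ⟨C, hC0, hC⟩ := hω.exists_log_le one_pos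
  -- The two constants serve ‖x‖ ≤ d and ‖x‖ > d. In m, the 1 pays for the factor |x_j| ≤
  -- e^{ω(|x_j|)+C} lost to rounding, and d l for ω(‖x‖) ≤ d ω(|x_j|).
  refine ⟨Real.exp (l * ω d) + Real.exp C, 1 + d * l, by positivity, by positivity,
    fun G B x hB hG h => ?_⟩
  rcases le_or_gt ‖x‖ d with hx | hx
  · have h1 := mul_le_mul_of_nonneg_left (hω.mono (norm_nonneg x) hx) hl.le
    calc G ≤ B * 1 := by linarith
      _ ≤ B * Real.exp (l * ω d + -(l * ω ‖x‖)) := by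
          gcongr; exact Real.one_le_exp (by linarith)
      _ = Real.exp (l * ω d) * B * Real.exp (-(l * ω ‖x‖)) := by rw [Real.exp_add]; ring
      _ ≤ _ := by gcongr; linarith [Real.exp_pos C]
  · obtain ⟨j, hj⟩ := exists_norm_le_mul_abs x hx
    have hd : 1 ≤ d := Nat.one_le_iff_ne_zero.2 fun h0 => by subst h0; exact j.elim0
    have hd0 : (0 : ℝ) < d := by exact_mod_cast hd
    have ht : 1 ≤ |x j| := by
      by_contra! h1
      nlinarith
    have ht0 : 0 < |x j| := by linarith
    have h1 := hω.le_of_forall_pow_mul_le (by positivity) hB ht (h j)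
    have h2 : |x j| ≤ Real.exp (1 * ω |x j| + C) := by
      rw [← Real.log_le_iff_le_exp ht0]; exact hC _ ht
    have h3 : ω ‖x‖ ≤ d * ω |x j| :=
      (hω.mono (norm_nonneg x) hj).trans (hω.nat_mul_le hd ht0.le)
    calc G ≤ B * (|x j| * Real.exp (-((1 + d * l) * ω |x j|))) := h1
      _ ≤ B * (Real.exp (1 * ω |x j| + C) * Real.exp (-((1 + d * l) * ω |x j|))) := by gcongr
      _ ≤ B * (Real.exp C * Real.exp (-(l * ω ‖x‖))) := by
          rw [← Real.exp_add, ← Real.exp_add]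
          refine mul_le_mul_of_nonneg_left (Real.exp_le_exp.2 ?_) hB
          nlinarith [mul_le_mul_of_nonneg_left h3 hl.le]
      _ = Real.exp C * B * Real.exp (-(l * ω ‖x‖)) := by ring
      _ ≤ _ := by gcongr; linarith [Real.exp_pos (l * ω d)]

lemma le_of_pSup_le {ω : ℝ → ℝ} {d : ℕ} {l m P : ℝ} (hP : 0 ≤ P) {f : Rd d → ℂ}
    (h : pSup ω l m f ≤ ENNReal.ofReal P) (α β : Fin d → ℕ) (x : Rd d) :
    |∏ j, x j ^ β j| * ‖multiDeriv α f x‖ ≤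
      P * (Real.exp (l * youngConj ω (((∑ j, α j : ℕ) : ℝ) / l)) *
        Real.exp (m * youngConj ω (((∑ j, β j : ℕ) : ℝ) / m))) := by
  have h1 := (ENNReal.ofReal_le_ofReal_iff hP).1
    ((show _ ≤ pSup ω l m f from
      le_iSup_of_le α (le_iSup_of_le β (le_iSup_of_le x le_rfl))).trans h)
  rw [norm_mul, norm_multiD, Complex.norm_real, Real.norm_eq_abs] at h1
  rw [← Real.exp_add, ← div_le_iff₀ (Real.exp_pos _), div_eq_mul_inv, ← Real.exp_neg]
  refine le_of_eq_of_le ?_ h1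
  congr 2
  ring

/-- The seminorms `p_{l,m}` control the weighted decay of `f` and of `𝓕 f`. -/
lemma exists_decayBound_of_pSup_le {ω : ℝ → ℝ} (hω : IsWeight ω) (d : ℕ) {l : ℝ} (hl : 0 < l) :
    ∃ C m : ℝ, 0 < C ∧ 0 < m ∧ ∀ (f : 𝓢(Rd d, ℂ)) (P : ℝ), 0 ≤ P →
      pSup ω m m f ≤ ENNReal.ofReal P →
      DecayBound ω l (C * P) f ∧ DecayBound ω l (C * P) (𝓕 (f : Rd d → ℂ)) := by
  -- The surplus 1 in the rate leaves e^{-ω}, which makes f and its derivatives integrable with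
  -- explicit bounds.
  obtain ⟨C, m, hC, hm, H⟩ := exists_le_of_moments hω d (l := l + 1) (by positivity)
  set I := ∫ ξ : Rd d, Real.exp (-(1 * ω ‖ξ‖)) with hI
  have hI0 : 0 ≤ I := MeasureTheory.integral_nonneg fun _ => Real.exp_nonneg _
  have hω1 := hω.nonneg 1 zero_le_one
  -- φ*(0) ≤ 0 because ω ≥ 0, so an index that is zero costs nothing.
  have hy0 : Real.exp (m * youngConj ω (((0 : ℕ) : ℝ) / m)) ≤ 1 := by
    apply Real.exp_le_one_iff.2
    refine mul_nonpos_of_nonneg_of_nonpos hm.le (IsWeight.youngConj_le fun t _ => ?_)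
    have := hω.nonneg _ (Real.exp_nonneg t)
    simpa using this
  refine ⟨C + C * (C * I), m, by positivity, hm, fun f P hP hf => ?_⟩
  have hder : ∀ (j : Fin d) (n : ℕ) (x : Rd d), ‖(pderiv j)^[n] f x‖ ≤
      C * (P * Real.exp (m * youngConj ω (n / m))) * Real.exp (-((l + 1) * ω ‖x‖)) := by
    intro j n x
    refine H _ _ x (by positivity) ?_ fun i k => ?_
    · have h1 := le_of_pSup_le hP hf (Pi.single j n) 0 x
      rw [multiDeriv_single] at h1
      simp only [Pi.zero_apply, pow_zero, Finset.prod_const_one, abs_one, one_mul,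
        Finset.sum_pi_single', Finset.mem_univ, if_true, Finset.sum_const_zero] at h1
      refine h1.trans ?_
      rw [← mul_assoc]
      exact mul_le_of_le_one_right (by positivity) hy0
    · have h1 := le_of_pSup_le hP hf (Pi.single j n) (Pi.single i k) x
      rw [multiDeriv_single] at h1
      have h2 : ∏ q, x q ^ (Pi.single i k : Fin d → ℕ) q = x i ^ k := by
        rw [Finset.prod_eq_single i (fun b _ hb => by simp [hb]) (by simp)]
        simp
      simp only [h2, abs_pow, Finset.sum_pi_single', Finset.mem_univ, if_true] at h1
      rw [mul_assoc]
      exact h1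
  have hmono : ∀ x : Rd d, Real.exp (-((l + 1) * ω ‖x‖)) ≤ Real.exp (-(l * ω ‖x‖)) := by
    intro x
    apply Real.exp_le_exp.2
    linarith [hω.nonneg _ (norm_nonneg x)]
  have hmono' : ∀ x : Rd d, Real.exp (-((l + 1) * ω ‖x‖)) ≤ Real.exp (-(1 * ω ‖x‖)) := by
    intro x
    apply Real.exp_le_exp.2
    nlinarith [mul_nonneg hl.le (hω.nonneg _ (norm_nonneg x))]
  have hf0 : DecayBound ω (l + 1) (C * P) f := by
    intro x
    have h0 := le_of_pSup_le hP hf 0 0 x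
    simp only [multiDeriv_zero, Pi.zero_apply, pow_zero, Finset.prod_const_one, abs_one, one_mul,
      Finset.sum_const_zero] at h0
    refine H _ _ x hP ?_ fun i k => ?_
    · exact h0.trans (mul_le_of_le_one_right hP
        (mul_le_one₀ hy0 (Real.exp_nonneg _) hy0))
    · have h1 := le_of_pSup_le hP hf 0 (Pi.single i k) x
      have h2 : ∏ q, x q ^ (Pi.single i k : Fin d → ℕ) q = x i ^ k := by
        rw [Finset.prod_eq_single i (fun b _ hb => by simp [hb]) (by simp)]
        simp
      simp only [h2, abs_pow, multiDeriv_zero, Pi.zero_apply, Finset.sum_const_zero,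
        Finset.sum_pi_single', Finset.mem_univ, if_true] at h1
      refine h1.trans ?_
      gcongr
      exact mul_le_of_le_one_left (Real.exp_nonneg _) hy0
  refine ⟨fun x => (hf0 x).trans ?_, fun ξ => ?_⟩
  · calc C * P * Real.exp (-((l + 1) * ω ‖x‖)) ≤ C * P * Real.exp (-(l * ω ‖x‖)) := by
          gcongr C * P * ?_; exact hmono x
      _ ≤ _ := by gcongr; linarith [mul_nonneg hC.le (mul_nonneg hC.le hI0)]
  · have hint : ∀ (g : Rd d → ℂ) (A : ℝ), 0 ≤ A →
        (∀ x, ‖g x‖ ≤ A * Real.exp (-((l + 1) * ω ‖x‖))) → ‖𝓕 g ξ‖ ≤ A * I := by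
      intro g A hA hg
      rw [Real.fourier_eq, hI, ← MeasureTheory.integral_const_mul]
      refine MeasureTheory.norm_integral_le_of_norm_le
        ((hω.integrable_exp_neg one_pos).const_mul A) (.of_forall fun v => ?_)
      rw [Circle.norm_smul]
      exact (hg v).trans (mul_le_mul_of_nonneg_left (hmono' v) hA)
    -- The moment criterion on the frequency side: |ξ_j|^n |𝓕 f(ξ)| ≤ |𝓕(∂_j^n f)(ξ)|, as 2π ≥ 1,
    -- and the right side is at most an L¹ norm bounded by `hder`.
    have h1 := H ‖𝓕 (f : Rd d → ℂ) ξ‖ (C * I * P) ξ (by positivity) ?_ fun j n => ?_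
    · refine h1.trans ?_
      calc C * (C * I * P) * Real.exp (-((l + 1) * ω ‖ξ‖))
          ≤ C * (C * I * P) * Real.exp (-(l * ω ‖ξ‖)) :=
            mul_le_mul_of_nonneg_left (hmono ξ) (by positivity)
        _ = C * (C * I) * P * Real.exp (-(l * ω ‖ξ‖)) := by ring
        _ ≤ _ := by gcongr; linarith
    · refine (hint f (C * P) (by positivity) hf0).trans (le_of_eq ?_)
      ring
    · obtain ⟨g, hg, hg'⟩ := exists_schwartz_iterate_pderiv f j n
      have h2 := hint g (C * (P * Real.exp (m * youngConj ω (n / m)))) (by positivity)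
        fun x => by rw [hg]; exact hder j n x
      rw [hg' ξ, norm_mul, norm_pow] at h2
      have h3 : |ξ j| ≤ ‖2 * Real.pi * Complex.I * (ξ j : ℂ)‖ := by
        simp only [norm_mul, Complex.norm_I, Complex.norm_real, Real.norm_eq_abs,
          Complex.norm_ofNat, abs_of_pos Real.pi_pos, mul_one]
        nlinarith [abs_nonneg (ξ j), Real.pi_gt_three]
      calc |ξ j| ^ n * ‖𝓕 (f : Rd d → ℂ) ξ‖
          ≤ ‖2 * Real.pi * Complex.I * (ξ j : ℂ)‖ ^ n * ‖𝓕 (f : Rd d → ℂ) ξ‖ := by gcongr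
        _ ≤ C * (P * Real.exp (m * youngConj ω (n / m))) * I := h2
        _ = _ := by ring

/-! ### Membership in the space, and the two normalisations. -/

/-- Only the bounds with α = 0 are needed; control of derivatives is recovered from them by the
Gaussian argument. -/
lemma exists_decayBound_of_mem {ω : ℝ → ℝ} (hω : IsWeight ω) {d : ℕ} {f : 𝓢(Rd d, ℂ)}
    (hf : f ∈ SOmega d ω) {l : ℝ} (hl : 0 < l) :
    ∃ B, DecayBound ω l B f ∧ DecayBound ω l B (𝓕 (f : Rd d → ℂ)) := by
  have key : ∀ g : Rd d → ℂ, WeightedDecay ω g → ∃ B, DecayBound ω l B g := by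
    intro g hg
    obtain ⟨B, hB⟩ := hg l hl 0
    refine ⟨B, fun x => ?_⟩
    have h := hB ⟨x, rfl⟩
    simp only [norm_multiD, multiDeriv_zero] at h
    rw [Real.exp_neg, ← div_eq_mul_inv, le_div_iff₀' (Real.exp_pos _)]
    exact h
  obtain ⟨B₁, h₁⟩ := key f hf.1
  obtain ⟨B₂, h₂⟩ := key _ hf.2
  refine ⟨max B₁ B₂, fun x => (h₁ x).trans ?_, fun ξ => ?_⟩
  · gcongr; exact le_max_left _ _
  · have h3 := h₂ ((2 * Real.pi) • ξ)
    rw [fourierHat_eq, smul_smul, inv_mul_cancel₀ (by positivity), one_smul,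
      SchwartzMap.fourier_coe] at h3
    have h4 : ω ‖ξ‖ ≤ ω ‖(2 * Real.pi) • ξ‖ := by
      apply hω.mono (norm_nonneg _)
      rw [norm_smul, Real.norm_of_nonneg (by positivity)]
      nlinarith [norm_nonneg ξ, Real.pi_gt_three]
    have hB := h₂.nonneg
    calc _ ≤ B₂ * Real.exp (-(l * ω ‖(2 * Real.pi) • ξ‖)) := h3
      _ ≤ max B₁ B₂ * Real.exp (-(l * ω ‖ξ‖)) := by
        gcongr; exact le_max_right _ _

lemma norm_fst_le_phaseNorm {d : ℕ} (z : Rd d × Rd d) : ‖z.1‖ ≤ phaseNorm z :=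
  Real.le_sqrt_of_sq_le (by nlinarith [sq_nonneg ‖z.2‖])

lemma norm_snd_le_phaseNorm {d : ℕ} (z : Rd d × Rd d) : ‖z.2‖ ≤ phaseNorm z :=
  Real.le_sqrt_of_sq_le (by nlinarith [sq_nonneg ‖z.1‖])

lemma phaseNorm_le {d : ℕ} (z : Rd d × Rd d) : phaseNorm z ≤ ‖z.1‖ + ‖z.2‖ :=
  Real.sqrt_le_iff.2 ⟨by positivity, by nlinarith [norm_nonneg z.1, norm_nonneg z.2]⟩

/-- The frequency rescaling by 2π is absorbed by 7, since 2π ≤ 7 and ω(7t) ≤ 7ω(t). -/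
lemma stftSup_le_of_normStft_le {ω : ℝ → ℝ} (hω : IsWeight ω) {d : ℕ} {l A : ℝ} (hl : 0 ≤ l)
    (hA : 0 ≤ A) {φ f : Rd d → ℂ}
    (h : ∀ x ξ, ‖normStft φ f x ξ‖ ≤ A * Real.exp (-(7 * l * (ω ‖x‖ + ω ‖ξ‖)))) :
    stftSup ω l φ f ≤ ENNReal.ofReal A := by
  refine iSup_le fun z => ENNReal.ofReal_le_ofReal ?_
  rw [stft_eq_normStft]
  set ξ := (2 * Real.pi)⁻¹ • z.2 with hξ
  have hz : ‖z.2‖ ≤ (7 : ℕ) * ‖ξ‖ := by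
    have h1 : z.2 = (2 * Real.pi) • ξ := by
      rw [hξ, smul_smul, mul_inv_cancel₀ (by positivity), one_smul]
    rw [h1, norm_smul, Real.norm_of_nonneg (by positivity)]
    gcongr
    norm_num
    linarith [Real.pi_lt_d2]
  have h1 : ω (phaseNorm z) ≤ 7 * (ω ‖z.1‖ + ω ‖ξ‖) := by
    have h2 : ω (phaseNorm z) ≤ ω (‖z.1‖ + ‖z.2‖) :=
      hω.mono (Real.sqrt_nonneg _) (phaseNorm_le z)
    have h3 := hω.subadditive _ _ (norm_nonneg z.1) (norm_nonneg z.2)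
    have h4 := (hω.mono (norm_nonneg _) hz).trans (hω.nat_mul_le (by norm_num) (norm_nonneg ξ))
    have h5 := hω.nonneg _ (norm_nonneg z.1)
    push_cast at h4
    linarith
  calc ‖normStft φ f z.1 ξ‖ * Real.exp (l * ω (phaseNorm z))
      ≤ A * Real.exp (-(7 * l * (ω ‖z.1‖ + ω ‖ξ‖))) * Real.exp (l * ω (phaseNorm z)) := by
        gcongr; exact h _ _
    _ = A * Real.exp (-(7 * l * (ω ‖z.1‖ + ω ‖ξ‖)) + l * ω (phaseNorm z)) := by
        rw [Real.exp_add]; ring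
    _ ≤ A * 1 := by
        gcongr
        apply Real.exp_le_one_iff.2
        nlinarith [mul_le_mul_of_nonneg_left h1 hl]
    _ = A := mul_one A

/-- The weight at z dominates the weights at both components, so twice it dominates their sum;
dilating ξ by 2π only helps. -/
lemma normStft_le_of_stftSup_le {ω : ℝ → ℝ} (hω : IsWeight ω) {d : ℕ} {l A : ℝ} (hl : 0 ≤ l)
    (hA : 0 ≤ A) {φ f : Rd d → ℂ} (h : stftSup ω (2 * l) φ f ≤ ENNReal.ofReal A) (x ξ : Rd d) :
    ‖normStft φ f x ξ‖ ≤ A * Real.exp (-(l * (ω ‖x‖ + ω ‖ξ‖))) := by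
  have h1 := (ENNReal.ofReal_le_ofReal_iff hA).1
    ((le_iSup_of_le (x, (2 * Real.pi) • ξ) le_rfl).trans h)
  rw [stft_eq_normStft] at h1
  simp only at h1
  rw [smul_smul, inv_mul_cancel₀ (by positivity), one_smul,
    ← le_div_iff₀ (Real.exp_pos _), div_eq_mul_inv, ← Real.exp_neg] at h1
  refine h1.trans (mul_le_mul_of_nonneg_left (Real.exp_le_exp.2 ?_) hA)
  have h2 := hω.mono (norm_nonneg _) (norm_fst_le_phaseNorm (x, (2 * Real.pi) • ξ))
  have h3 := hω.mono (norm_nonneg _) (norm_snd_le_phaseNorm (x, (2 * Real.pi) • ξ))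
  have h4 : ω ‖ξ‖ ≤ ω ‖(2 * Real.pi) • ξ‖ := by
    apply hω.mono (norm_nonneg _)
    rw [norm_smul, Real.norm_of_nonneg (by positivity)]
    nlinarith [norm_nonneg ξ, Real.pi_gt_three]
  simp only at h2 h3
  nlinarith [mul_le_mul_of_nonneg_left h2 hl, mul_le_mul_of_nonneg_left (h4.trans h3) hl]

lemma exists_stftSup_le {ω : ℝ → ℝ} (hω : IsWeight ω) {d : ℕ} {φ : 𝓢(Rd d, ℂ)}
    (hφ : φ ∈ SOmega d ω) {l : ℝ} (hl : 0 < l) :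
    ∃ C L : ℝ, 0 ≤ C ∧ 0 < L ∧ ∀ (f : 𝓢(Rd d, ℂ)) (B : ℝ), DecayBound ω L B f →
      DecayBound ω L B (𝓕 (f : Rd d → ℂ)) → stftSup ω l φ f ≤ ENNReal.ofReal (C * B) := by
  obtain ⟨G, hG, hG'⟩ := exists_decayBound_of_mem hω hφ (l := 2 * (7 * l)) (by positivity)
  have hG0 := hG.nonneg
  have hI0 : 0 ≤ ∫ ξ : Rd d, Real.exp (-(1 * ω ‖ξ‖)) :=
    MeasureTheory.integral_nonneg fun _ => Real.exp_nonneg _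
  refine ⟨G * ∫ ξ : Rd d, Real.exp (-(1 * ω ‖ξ‖)), 2 * (7 * l) + 1, by positivity, by positivity,
    fun f B hf hf' => ?_⟩
  have hB := hf.nonneg
  refine stftSup_le_of_normStft_le hω hl.le (by positivity) fun x ξ => ?_
  refine (norm_normStft_le_phase hω (by positivity) f.integrable φ.continuous φ.integrable
    (𝓕 φ).integrable hf hf' hG hG' x ξ).trans (le_of_eq ?_)
  ring

/-! ### The suprema as seminorms, and the equivalence. -/

/-- A pointwise finite weighted supremum of linear functionals is a seminorm. -/
lemma exists_seminorm_eq_iSup {E ι : Type*} [AddCommGroup E] [Module ℂ E] (T : ι → E → ℂ)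
    (hT : ∀ i (c : ℂ) (f g : E), T i (c • f + g) = c * T i f + T i g) (w : ι → ℝ)
    (hw : ∀ i, 0 ≤ w i) (hfin : ∀ f, ⨆ i, ENNReal.ofReal (‖T i f‖ * w i) ≠ ⊤) :
    ∃ p : Seminorm ℂ E, ∀ f, ENNReal.ofReal (p f) = ⨆ i, ENNReal.ofReal (‖T i f‖ * w i) := by
  have hT0 : ∀ i, T i 0 = 0 := by
    intro i
    have := hT i 1 0 0
    simpa using this
  refine ⟨Seminorm.ofSMulLE (fun f => (⨆ i, ENNReal.ofReal (‖T i f‖ * w i)).toReal) ?_ ?_ ?_,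
    fun f => ENNReal.ofReal_toReal (hfin f)⟩
  · simp [hT0]
  · intro f g
    rw [← ENNReal.toReal_add (hfin f) (hfin g)]
    refine ENNReal.toReal_mono (ENNReal.add_ne_top.2 ⟨hfin f, hfin g⟩) (iSup_le fun i => ?_)
    refine le_trans ?_ (add_le_add (le_iSup (fun i => ENNReal.ofReal (‖T i f‖ * w i)) i)
      (le_iSup (fun i => ENNReal.ofReal (‖T i g‖ * w i)) i))
    have hi := hw i
    rw [← ENNReal.ofReal_add (by positivity) (by positivity), ← add_mul]
    have h1 : T i (f + g) = T i f + T i g := by simpa using hT i 1 f g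
    rw [h1]
    exact ENNReal.ofReal_le_ofReal (mul_le_mul_of_nonneg_right (norm_add_le _ _) hi)
  · intro c f
    rw [← ENNReal.toReal_ofReal (norm_nonneg c), ← ENNReal.toReal_mul]
    refine ENNReal.toReal_mono (ENNReal.mul_ne_top ENNReal.ofReal_ne_top (hfin f))
      (iSup_le fun i => ?_)
    have h1 : T i (c • f) = c * T i f := by simpa [hT0] using hT i c f 0
    rw [h1, norm_mul, mul_assoc, ENNReal.ofReal_mul (norm_nonneg c)]
    exact mul_le_mul_right (le_iSup (fun i => ENNReal.ofReal (‖T i f‖ * w i)) i) _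

lemma coe_smul_add {d : ℕ} {ω : ℝ → ℝ} (c : ℂ) (f g : SOmega d ω) :
    ((c • f + g : SOmega d ω).1 : Rd d → ℂ) = c • (f.1 : Rd d → ℂ) + (g.1 : Rd d → ℂ) := by
  funext x; simp

lemma normStft_smul_add {d : ℕ} (φ f g : 𝓢(Rd d, ℂ)) (c : ℂ) (x ξ : Rd d) :
    normStft φ (c • (f : Rd d → ℂ) + (g : Rd d → ℂ)) x ξ =
      c * normStft φ f x ξ + normStft φ g x ξ := by
  have hf := (Real.fourierIntegral_convergent_iff ξ).2 (integrable_mul_conj_schwartz f φ x)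
  have hg := (Real.fourierIntegral_convergent_iff ξ).2 (integrable_mul_conj_schwartz g φ x)
  simp only [normStft, Real.fourier_eq]
  rw [← MeasureTheory.integral_const_mul, ← MeasureTheory.integral_add (hf.const_mul c) hg]
  congr 1; funext y
  simp only [Pi.add_apply, Pi.smul_apply, smul_eq_mul, Circle.smul_def]
  ring

lemma exists_seminorm_pSup {ω : ℝ → ℝ} (hω : IsWeight ω) (d : ℕ) {l m : ℝ} (hl : 0 < l)
    (hm : 0 < m) :
    ∃ p : Seminorm ℂ (SOmega d ω), ∀ f, ENNReal.ofReal (p f) = pSup ω l m f.1 := by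
  have heq : ∀ f : SOmega d ω, pSup ω l m f.1 =
      ⨆ i : (Fin d → ℕ) × (Fin d → ℕ) × Rd d, ENNReal.ofReal
        (‖((∏ j, i.2.2 j ^ i.2.1 j : ℝ) : ℂ) * multiD i.1 f.1 i.2.2‖ *
          Real.exp (-(l * youngConj ω (((∑ j, i.1 j : ℕ) : ℝ) / l))
            - m * youngConj ω (((∑ j, i.2.1 j : ℕ) : ℝ) / m))) := by
    intro f
    simp only [iSup_prod, pSup]
  simp only [heq]
  refine exists_seminorm_eq_iSup
    (fun (i : (Fin d → ℕ) × (Fin d → ℕ) × Rd d) (f : SOmega d ω) =>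
      ((∏ j, i.2.2 j ^ i.2.1 j : ℝ) : ℂ) * multiD i.1 f.1 i.2.2) ?_ _
    (fun i => Real.exp_nonneg _) fun f => ?_
  · intro i c f g
    simp only
    rw [coe_smul_add, multiD_lin i.1 c (f.1.smooth ⊤) (g.1.smooth ⊤)]
    ring
  · obtain ⟨C, L, -, hL, h⟩ := exists_pSup_le hω d hl hm
    obtain ⟨B, hB, hB'⟩ := exists_decayBound_of_mem hω f.2 hL
    have h1 := h f.1 B hB hB'
    rw [heq] at h1
    exact ne_top_of_le_ne_top ENNReal.ofReal_ne_top h1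

lemma exists_seminorm_stftSup {ω : ℝ → ℝ} (hω : IsWeight ω) {d : ℕ} (φ : SOmega d ω) {l : ℝ}
    (hl : 0 < l) :
    ∃ p : Seminorm ℂ (SOmega d ω), ∀ f, ENNReal.ofReal (p f) = stftSup ω l φ.1 f.1 := by
  refine exists_seminorm_eq_iSup (fun (z : Rd d × Rd d) (f : SOmega d ω) => stft φ.1 f.1 z) ?_ _
    (fun z => Real.exp_nonneg _) fun f => ?_
  · intro z c f g
    rw [coe_smul_add, stft_eq_normStft, normStft_smul_add, stft_eq_normStft, stft_eq_normStft]
  · obtain ⟨C, L, -, hL, h⟩ := exists_stftSup_le hω φ.2 hl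
    obtain ⟨B, hB, hB'⟩ := exists_decayBound_of_mem hω f.2 hL
    exact ne_top_of_le_ne_top ENNReal.ofReal_ne_top (h f.1 B hB hB')

end UltraSchwartz

end

theorem mainTheorem10 (d : ℕ) (ω : ℝ → ℝ) (hω : UltraSchwartz.IsWeight ω)
    (φ : UltraSchwartz.SOmega d ω) (hφ : φ ≠ 0) :
    ∃ (P : Set.Ioi (0 : ℝ) × Set.Ioi (0 : ℝ) → Seminorm ℂ (UltraSchwartz.SOmega d ω))
      (N : Set.Ioi (0 : ℝ) → Seminorm ℂ (UltraSchwartz.SOmega d ω)),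
      (∀ (l m : Set.Ioi (0 : ℝ)) (f : UltraSchwartz.SOmega d ω),
        ENNReal.ofReal (P (l, m) f) = UltraSchwartz.pSup ω (l : ℝ) (m : ℝ) f.1) ∧
      (∀ (l : Set.Ioi (0 : ℝ)) (f : UltraSchwartz.SOmega d ω),
        ENNReal.ofReal (N l f) = UltraSchwartz.stftSup ω (l : ℝ) φ.1 f.1) ∧
      Seminorm.IsBounded P N LinearMap.id ∧
      Seminorm.IsBounded N P LinearMap.id := by
  choose P hP using fun i : Set.Ioi (0 : ℝ) × Set.Ioi (0 : ℝ) =>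
    UltraSchwartz.exists_seminorm_pSup hω d i.1.2 i.2.2
  choose N hN using fun i : Set.Ioi (0 : ℝ) => UltraSchwartz.exists_seminorm_stftSup hω φ i.2
  refine ⟨P, N, fun l m f => hP (l, m) f, hN, Seminorm.IsBounded.of_real fun l => ?_,
    Seminorm.IsBounded.of_real fun i => ?_⟩
  -- The seminorm of V_φ f is bounded through decay at rate L, by a single p with both parameters
  -- equal to m.
  · obtain ⟨C, L, hC, hL, h⟩ := UltraSchwartz.exists_stftSup_le hω φ.2 l.2
    obtain ⟨C', m, hC', hm, h'⟩ := UltraSchwartz.exists_decayBound_of_pSup_le hω d hL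
    refine ⟨{(⟨m, hm⟩, ⟨m, hm⟩)}, C * C', fun f => ?_⟩
    rw [Finset.sup_singleton]
    have h0 : 0 ≤ P (⟨m, hm⟩, ⟨m, hm⟩) f := apply_nonneg _ _
    obtain ⟨h1, h2⟩ := h' f.1 _ h0 (hP (⟨m, hm⟩, ⟨m, hm⟩) f).ge
    have h3 := h f.1 _ h1 h2
    rw [← hN, ENNReal.ofReal_le_ofReal_iff (by positivity), ← mul_assoc] at h3
    exact h3
  -- Here φ ≠ 0 is essential, to recover f. In 2(L + 1), the 1 pays for the integral in the
  -- inversion formula and the 2 for splitting ω(z) between x and ξ.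
  · obtain ⟨C, L, hC, hL, h⟩ := UltraSchwartz.exists_pSup_le hω d i.1.2 i.2.2
    have hφ' : φ.1 ≠ 0 := fun h0 => hφ (Subtype.ext h0)
    obtain ⟨C', hC', h'⟩ := UltraSchwartz.exists_decayBound_of_normStft_le hω hL.le hφ'
    have hm : 0 < 2 * (L + 1) := by positivity
    refine ⟨{⟨2 * (L + 1), hm⟩}, C * C', fun f => ?_⟩
    rw [Finset.sup_singleton]
    have h0 : 0 ≤ N ⟨2 * (L + 1), hm⟩ f := apply_nonneg _ _
    obtain ⟨h1, h2⟩ := h' f.1 _ h0 (UltraSchwartz.normStft_le_of_stftSup_le hω (by positivity) h0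
      (hN ⟨2 * (L + 1), hm⟩ f).ge)
    have h3 := h f.1 _ h1 h2
    rw [← hP, ENNReal.ofReal_le_ofReal_iff (by positivity), ← mul_assoc] at h3
    exact h3
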